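/- **Setting.** There are $K\ge 1$ arms; in every round $t=0,\dots,T-1$ ($T\ge 1$) arm $k$ produces a reward drawn from a distribution $\nu_k$ on $[0,1]$ with mean $\mu_k$, all rewards being independent. In round $t$ a (deterministic) finite set of $N_t\le N_m\le K$ players is present; each present player chooses an arm, and a player collides (and obtains no reward) if another present player chooses the same arm. A non-colliding player observes the reward of her arm. With $\mu_{(1)}\ge\dots\ge\mu_{(K)}$ the ordered means, the regret is $R=\sum_{t<T}\big(\sum_{i\le N_t}\mu_{(i)}-\sum_{j\text{ present, not colliding in round }t}\mu_{a_j(t)}\big)$, where $a_j(t)$ is the arm chosen by $j$. **The algorithm (Dynamic Musical Chairs, DMC), with parameters $T_0<T_1$.** Time is divided into epochs of $T_1$ rounds. In the first $T_0$ rounds of an epoch (the learning phase) every player chooses arms uniformly at random. She then sorts the arms by decreasing empirical mean reward (over her non-colliding observations in this phase, ties broken by any fixed measurable rule) and computes $N^*=\mathrm{round}\big(\log(\tfrac{T_0-C}{T_0})/\log(1-\tfrac1K)+1\big)$, where $C$ is the number of her collisions in this phase ($N^*=K$ if $C=T_0$). In the remaining rounds of the epoch she chooses, in each round, a uniformly random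 arm among the first $N^*$ of her list until she has no collision; from then on she is fixed on that arm until the epoch ends. A player who enters during an epoch chooses arms uniformly at random until that epoch ends. Players do not enter or leave during learning phases (the set of present players is constant during each of them). Let $e$ and $l$ be the total numbers of players entering and leaving during the $T$ rounds. **Good event.** A sorted list of the arms is an $\epsilon$-correct ranking if arm $i$ is listed before arm $j$ whenever $\mu_i-\mu_j>\epsilon$. Let $G$ be the event that in every epoch whose learning phase is completed within the $T$ rounds, every player taking part in it learns an $\epsilon$-correct ranking and has $N^*$ equal to the number of players present. Let $T_f$ be the largest, over epochs and players, of the conditional expectations given $G$ of the time the player needs to fix on an arm, i.e. the number of rounds after the learning phase of the epoch (and before round $T$) that she, having been present since the beginning of the epoch, begins without being fixed. **Statement.** Let $\Delta_{\min}$ be a lower bound on $\mu_{(i)}-\mu_{(i+1)}$ for all $i\le N_m$ with $i+1\le K$, let $0<\epsilon<\Delta_{\min}$ and $\delta\in(0,1)$, let $$T_0=\left\lceil\max\left(\frac K2\ln\frac{2K^2}{\delta/(2T)},\ \frac{16K}{\epsilon^2}\ln\frac{4K^2}{\delta/(2T)},\ \frac{K^2\ln(4T/\delta)}{0.02}\right)\right\rceil$$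 and let $T_1>T_0$ be an integer. Then $\Pr(G)\ge 1-\delta$, $T_f\le e^2N_m$ (here $e^2=\exp(2)$), and the expected regret of DMC conditioned on $G$ satisfies $$\mathbb E[R\mid G]\ \le\ \Big\lceil\frac{T}{T_1}\Big\rceil\, N_m\,(T_0+2T_f)\;+\;e\cdot 2(T_1-T_0)\;+\;l\,(T_1-T_0).$$ -/

import Mathlib

open MeasureTheory

namespace DMC

/-! Arms are `Fin K`, players are the elements of a finite type `P`. Rounds are `0, 1, …, T - 1`;
epoch `m` consists of the rounds `m * T₁, …, (m + 1) * T₁ - 1`, and its first `T₀` rounds are the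
learning phase. `active t` is the set of players present in round `t`. -/

/-! ### Sources of randomness -/

/-- The private coin of one player for one round: a uniform arm (used for exploring) and, for every
`n < K`, a uniform element of `{0, …, n}` (used for drawing among the first `n + 1` positions of a
list of arms). -/
abbrev Coin (K : ℕ) : Type := Fin K × ((n : Fin K) → Fin (n.val + 1))

/-- Everything that is random in one round: the reward of every arm and the coin of every player. -/
abbrev Round (K : ℕ) (P : Type*) := (Fin K → ℝ) × (P → Coin K)

/-- An outcome of the game: the randomness of all rounds. -/
abbrev Outcome (K : ℕ) (P : Type*) := ℕ → Round K P

/-- The law of a coin: all components are uniform and independent. -/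
noncomputable def coinLaw (K : ℕ) : Measure (Coin K) :=
  (ProbabilityTheory.uniformOn Set.univ).prod
    (Measure.pi fun _ => ProbabilityTheory.uniformOn Set.univ)

/-- The law of one round: the reward of arm `k` has law `ν k`, every player has her own coin, and
all of these are independent. -/
noncomputable def roundLaw {K : ℕ} (P : Type*) [Fintype P] (ν : Fin K → Measure ℝ) :
    Measure (Round K P) :=
  (Measure.pi ν).prod (Measure.pi fun _ : P => coinLaw K)

instance {K : ℕ} [NeZero K] : IsProbabilityMeasure (coinLaw K) := by
  have h (n : ℕ) [NeZero n] : IsProbabilityMeasure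
      (ProbabilityTheory.uniformOn (Set.univ : Set (Fin n))) :=
    ProbabilityTheory.isProbabilityMeasure_uniformOn Set.finite_univ Set.univ_nonempty
  have h1 := h K
  have h2 (n : Fin K) := h (n.val + 1)
  unfold coinLaw
  infer_instance

instance {K : ℕ} [NeZero K] (P : Type*) [Fintype P] (ν : Fin K → Measure ℝ)
    [∀ k, IsProbabilityMeasure (ν k)] : IsProbabilityMeasure (roundLaw P ν) := by
  unfold roundLaw
  infer_instance

/-- The law of the game: the rounds are independent and identically distributed. -/
noncomputable def gameLaw {K : ℕ} [NeZero K] (P : Type*) [Fintype P] (ν : Fin K → Measure ℝ)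
    [∀ k, IsProbabilityMeasure (ν k)] : Measure (Outcome K P) :=
  Measure.infinitePi fun _ => roundLaw P ν

/-! ### Means and rankings -/

/-- The expected reward of arm `k`. -/
noncomputable def mean {K : ℕ} (ν : Fin K → Measure ℝ) (k : Fin K) : ℝ := ∫ x, x ∂(ν k)

/-- An enumeration of the arms by decreasing expected reward: `bestArm ν i` is the `(i + 1)`-th
best arm. -/
noncomputable def bestArm {K : ℕ} (ν : Fin K → Measure ℝ) : Equiv.Perm (Fin K) :=
  Tuple.sort fun k => -mean ν k

/-- The sum of the expected rewards of the `n` best arms. -/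
noncomputable def topSum {K : ℕ} (ν : Fin K → Measure ℝ) (n : ℕ) : ℝ :=
  ∑ i : Fin K with i.val < n, mean ν (bestArm ν i)

/-- A sorting procedure: it turns a vector of empirical means into a list of the arms
(position `↦` arm) with decreasing empirical means. Ties are broken in any (measurable) way. -/
structure IsSorting {K : ℕ} (srt : (Fin K → ℝ) → Equiv.Perm (Fin K)) : Prop where
  antitone : ∀ v, Antitone (v ∘ srt v)
  measurable : ∀ σ, MeasurableSet {v | srt v = σ}

/-- The list `A` (position `↦` arm) is an `ε`-correct ranking. -/
def IsCorrectRanking {K : ℕ} (ν : Fin K → Measure ℝ) (ε : ℝ) (A : Equiv.Perm (Fin K)) : Prop :=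
  ∀ i j, ε < mean ν i - mean ν j → A.symm i < A.symm j

/-! ### Collisions and the learning phase -/

/-- Player `j` collides, when the players in `S` choose arms according to `a`. -/
def Collides {K : ℕ} {P : Type*} (S : Finset P) (a : P → Fin K) (j : P) : Prop :=
  ∃ i ∈ S, i ≠ j ∧ a i = a j

instance {K : ℕ} {P : Type*} [DecidableEq P] (S : Finset P) (a : P → Fin K) :
    DecidablePred (Collides S a) :=
  fun j => inferInstanceAs (Decidable (∃ i ∈ S, i ≠ j ∧ a i = a j))

section Game

variable {K : ℕ} {P : Type*} [DecidableEq P]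

/-- The arm that player `j` chooses in round `t` if she explores. -/
def explore (ω : Outcome K P) (t : ℕ) (j : P) : Fin K := ((ω t).2 j).1

/-- The rounds of the learning phase of epoch `m` in which player `j` had a collision. -/
def collisionRounds (active : ℕ → Finset P) (T₀ T₁ : ℕ) (ω : Outcome K P) (m : ℕ) (j : P) :
    Finset ℕ :=
  {t ∈ Finset.Ico (m * T₁) (m * T₁ + T₀) | Collides (active t) (explore ω t) j}

/-- The rounds of the learning phase of epoch `m` in which player `j` observed arm `k`. -/
def observationRounds (active : ℕ → Finset P) (T₀ T₁ : ℕ) (ω : Outcome K P) (m : ℕ) (j : P)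
    (k : Fin K) : Finset ℕ :=
  {t ∈ Finset.Ico (m * T₁) (m * T₁ + T₀) |
    explore ω t j = k ∧ ¬ Collides (active t) (explore ω t) j}

/-- The empirical mean of arm `k` for player `j` in epoch `m` (`0` if she never observed it). -/
noncomputable def empiricalMean (active : ℕ → Finset P) (T₀ T₁ : ℕ) (ω : Outcome K P) (m : ℕ)
    (j : P) (k : Fin K) : ℝ :=
  (∑ t ∈ observationRounds active T₀ T₁ ω m j k, (ω t).1 k) /
    ((observationRounds active T₀ T₁ ω m j k).card : ℝ)

/-- The sorted list of arms of player `j` after the learning phase of epoch `m`. -/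
noncomputable def ranking (srt : (Fin K → ℝ) → Equiv.Perm (Fin K)) (active : ℕ → Finset P)
    (T₀ T₁ : ℕ) (ω : Outcome K P) (m : ℕ) (j : P) : Equiv.Perm (Fin K) :=
  srt (empiricalMean active T₀ T₁ ω m j)

/-- The estimate of the number of players made by player `j` in epoch `m`. -/
noncomputable def estimate (active : ℕ → Finset P) (T₀ T₁ : ℕ) (ω : Outcome K P) (m : ℕ) (j : P) :
    ℤ :=
  if (collisionRounds active T₀ T₁ ω m j).card = T₀ then (K : ℤ)
  else round (Real.log (((T₀ : ℝ) - (collisionRounds active T₀ T₁ ω m j).card) / T₀) /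
    Real.log (1 - 1 / (K : ℝ)) + 1)

/-! ### The choices of the players -/

/-- Player `j` has been present from the beginning of the epoch of round `t` through round `t`. -/
def Synced (active : ℕ → Finset P) (T₁ t : ℕ) (j : P) : Prop :=
  ∀ s ∈ Finset.Icc (t / T₁ * T₁) t, j ∈ active s

instance (active : ℕ → Finset P) (T₁ t : ℕ) (j : P) : Decidable (Synced active T₁ t j) :=
  inferInstanceAs (Decidable (∀ s ∈ Finset.Icc (t / T₁ * T₁) t, j ∈ active s))

/-- Player `j` runs the Musical Chairs part of the algorithm in round `t`: the learning phase is
over and she took part in the epoch from its beginning. -/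
def InChairs (active : ℕ → Finset P) (T₀ T₁ t : ℕ) (j : P) : Prop :=
  T₀ ≤ t % T₁ ∧ Synced active T₁ t j

instance (active : ℕ → Finset P) (T₀ T₁ t : ℕ) (j : P) : Decidable (InChairs active T₀ T₁ t j) :=
  inferInstanceAs (Decidable (T₀ ≤ t % T₁ ∧ Synced active T₁ t j))

/-- The arm drawn by an unfixed player `j` in a Musical Chairs round `t`: the arm in a uniform
position among the first `estimate` positions of her list (an estimate above `K` is read as `K`;
estimates are never below `1`). -/
noncomputable def chairsDraw [NeZero K] (srt : (Fin K → ℝ) → Equiv.Perm (Fin K))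
    (active : ℕ → Finset P) (T₀ T₁ : ℕ) (ω : Outcome K P) (t : ℕ) (j : P) : Fin K :=
  let n : Fin K := ⟨min (estimate active T₀ T₁ ω (t / T₁) j).toNat K - 1, by
    have := NeZero.pos K
    omega⟩
  ranking srt active T₀ T₁ ω (t / T₁) j (Fin.castLE n.isLt (((ω t).2 j).2 n))

/-- The arm chosen by player `j` in round `t`, where `fixed i` is the arm on which player `i` is
fixed before that round (if any). Everyone explores in the learning phase; a player who entered
during the current epoch explores until the epoch ends. -/
noncomputable def armGiven [NeZero K] (srt : (Fin K → ℝ) → Equiv.Perm (Fin K))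
    (active : ℕ → Finset P) (T₀ T₁ : ℕ) (ω : Outcome K P) (t : ℕ) (fixed : P → Option (Fin K))
    (j : P) : Fin K :=
  if InChairs active T₀ T₁ t j then
    (fixed j).getD (chairsDraw srt active T₀ T₁ ω t j)
  else explore ω t j

/-- The arm on which player `j` is fixed at the beginning of round `t` (`none` if she is not fixed).
All players are unfixed at the beginning of an epoch; an unfixed player in Musical Chairs becomes
fixed on the arm she has chosen when she has no collision. -/
noncomputable def fixedArm [NeZero K] (srt : (Fin K → ℝ) → Equiv.Perm (Fin K))
    (active : ℕ → Finset P) (T₀ T₁ : ℕ) (ω : Outcome K P) : ℕ → P → Option (Fin K)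
  | 0, _ => none
  | t + 1, j =>
    let fixed := fixedArm srt active T₀ T₁ ω t
    let a := armGiven srt active T₀ T₁ ω t fixed
    if (t + 1) % T₁ = 0 then none
    else if fixed j = none ∧ InChairs active T₀ T₁ t j ∧ ¬ Collides (active t) a j then some (a j)
    else fixed j

/-- The arm chosen by player `j` in round `t`. -/
noncomputable def arm [NeZero K] (srt : (Fin K → ℝ) → Equiv.Perm (Fin K))
    (active : ℕ → Finset P) (T₀ T₁ : ℕ) (ω : Outcome K P) (t : ℕ) (j : P) : Fin K :=
  armGiven srt active T₀ T₁ ω t (fixedArm srt active T₀ T₁ ω t) j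

/-! ### The quantities in the regret bound -/

/-- The regret in `T` rounds: in each round the sum of the expected rewards of the best arms, as
many as there are players, minus the expected rewards of the arms of the players without collision.
It depends on `ω` through the choices of the players. -/
noncomputable def regret [NeZero K] (ν : Fin K → Measure ℝ)
    (srt : (Fin K → ℝ) → Equiv.Perm (Fin K)) (active : ℕ → Finset P) (T T₀ T₁ : ℕ)
    (ω : Outcome K P) : ℝ :=
  ∑ t ∈ Finset.range T, (topSum ν (active t).card -
    ∑ j ∈ active t, if Collides (active t) (arm srt active T₀ T₁ ω t) j then 0
      else mean ν (arm srt active T₀ T₁ ω t j))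

/-- The time player `j` takes to fix on an arm in epoch `m`: the number of Musical Chairs rounds
that she begins unfixed (so the round in which she fixes is counted). -/
noncomputable def fixTime [NeZero K] (srt : (Fin K → ℝ) → Equiv.Perm (Fin K))
    (active : ℕ → Finset P) (T T₀ T₁ : ℕ) (m : ℕ) (j : P) (ω : Outcome K P) : ℝ :=
  (({t ∈ Finset.range T | t / T₁ = m ∧ InChairs active T₀ T₁ t j ∧
    fixedArm srt active T₀ T₁ ω t j = none} : Finset ℕ).card : ℝ)

/-- The event that in each epoch whose learning phase is completed within the `T` rounds, all
players taking part in it learn an `ε`-correct ranking and the number of players. -/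
def goodEvent (ν : Fin K → Measure ℝ) (srt : (Fin K → ℝ) → Equiv.Perm (Fin K))
    (active : ℕ → Finset P) (T T₀ T₁ : ℕ) (ε : ℝ) : Set (Outcome K P) :=
  {ω | ∀ m, m * T₁ + T₀ ≤ T → ∀ j ∈ active (m * T₁),
    IsCorrectRanking ν ε (ranking srt active T₀ T₁ ω m j) ∧
    estimate active T₀ T₁ ω m j = (active (m * T₁)).card}

/-- The law of the game conditioned on the good event. -/
noncomputable def goodLaw [NeZero K] [Fintype P] (ν : Fin K → Measure ℝ)
    [∀ k, IsProbabilityMeasure (ν k)] (srt : (Fin K → ℝ) → Equiv.Perm (Fin K))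
    (active : ℕ → Finset P) (T T₀ T₁ : ℕ) (ε : ℝ) : Measure (Outcome K P) :=
  ProbabilityTheory.cond (gameLaw P ν) (goodEvent ν srt active T T₀ T₁ ε)

/-- `T_f`: the largest expected time, over all epochs and players, that a player takes to fix on an
arm (given the good event). -/
noncomputable def expectedFixTime [NeZero K] [Fintype P] (ν : Fin K → Measure ℝ)
    [∀ k, IsProbabilityMeasure (ν k)] (srt : (Fin K → ℝ) → Equiv.Perm (Fin K))
    (active : ℕ → Finset P) (T T₀ T₁ : ℕ) (ε : ℝ) : ℝ :=
  ⨆ p : Fin ⌈(T : ℝ) / T₁⌉₊ × P,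
    ∫ ω, fixTime srt active T T₀ T₁ p.1 p.2 ω ∂(goodLaw ν srt active T T₀ T₁ ε)

/-- The total number of players entering during `T` rounds (each entrance counts). -/
def entering (active : ℕ → Finset P) (T : ℕ) : ℕ :=
  ∑ t ∈ Finset.range (T - 1), (active (t + 1) \ active t).card

/-- The total number of players leaving during `T` rounds (each departure counts). -/
def leaving (active : ℕ → Finset P) (T : ℕ) : ℕ :=
  ∑ t ∈ Finset.range (T - 1), (active t \ active (t + 1)).card

end Game

/-- The length of the learning phase. -/
noncomputable def learningTime (K T : ℕ) (ε δ : ℝ) : ℕ :=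
  ⌈max (max ((K : ℝ) / 2 * Real.log (2 * (K : ℝ) ^ 2 / (δ / (2 * T))))
      (16 * (K : ℝ) / ε ^ 2 * Real.log (4 * (K : ℝ) ^ 2 / (δ / (2 * T)))))
    ((K : ℝ) ^ 2 * Real.log (4 * T / δ) / 0.02)⌉₊

end DMC

/-! Probability enters at two places only: the lower bound on the probability of the good event, and
the geometric decay of the time to fix. On the good event the regret is bounded pathwise, by
counting.

Good event. The set of N players is constant during a learning phase, so a player avoids collision
in a round with probability (1 - 1/K)^(N-1). Hoeffding's inequality keeps the observed frequency
within 1/(10K) of this value, which is precise enough for the rounded logarithm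
(`round_log_div_log`). As that power is at least 1/e, each arm is observed with probability at least
1/(eK) per round; a Chernoff bound that keeps the random number of observations inside the
exponential moment (`gameLaw_sum_rewardDeviation_le`) puts all empirical means within ε/2. A given
player fails in a given epoch with probability at most δ/T, and there are at most (T/T₀)K ≤ T such
pairs.

Fixing. As ε is below the gaps, all participants of an epoch draw from the same N best arms. By
pigeonhole an unfixed player has an arm there on which no other participant is fixed. She draws it
with probability 1/N; the other unfixed players all avoid it with probability at least 1/e, and so
do the newcomers (`Learned.le_coinsLaw_not_collides`). The good event depends on learning rounds
only, so resampling a Musical Chairs round does not affect it, and given the good event the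
probability of being unfixed shrinks by the factor 1 - 1/(e² N_m) per round. Summing the geometric
series gives e² N_m.

Regret. A learning round costs at most N_m. In a Musical Chairs round the fixed players sit on
distinct good arms. An unfixed player or a newcomer costs at most 2, her own reward and that of one
fixed player she may hit; a departure costs at most 1, since the remaining arms were chosen for the
old number of players (`chairs_round_regret_le`). Each entry or departure is charged to at most T₁ -
T₀ rounds. -/

namespace DMC

open ProbabilityTheory

set_option linter.unusedSectionVars false

/-! ### Product structure of the game: resampling a round, exponential moments, laws of coins -/

section Probability

variable {K : ℕ} [NeZero K] {P : Type*} [Fintype P]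
  (ν : Fin K → Measure ℝ) [∀ k, IsProbabilityMeasure (ν k)]

instance : IsProbabilityMeasure (gameLaw P ν) := by
  unfold gameLaw; infer_instance

theorem measurable_update_prod (t : ℕ) :
    Measurable (fun p : Outcome K P × Round K P => Function.update p.1 t p.2) := by
  rw [measurable_pi_iff]
  intro s
  by_cases h : s = t
  · subst h; simpa using measurable_snd
  · simp only [Function.update_of_ne h]
    exact (measurable_pi_apply s).comp measurable_fst

/-- Resampling the randomness of one round does not change the law of the game. -/
theorem gameLaw_map_update (t : ℕ) :
    ((gameLaw P ν).prod (roundLaw P ν)).map (fun p => Function.update p.1 t p.2) =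
      gameLaw P ν := by
  have hm := measurable_update_prod (K := K) (P := P) t
  refine Measure.eq_infinitePi _ fun s B hB => ?_
  rw [Measure.map_apply hm (MeasurableSet.pi s.countable_toSet fun i _ => hB i)]
  by_cases hts : t ∈ s
  · have h : (fun p : Outcome K P × Round K P => Function.update p.1 t p.2) ⁻¹'
        ((s : Set ℕ).pi B) = (((s.erase t : Finset ℕ) : Set ℕ).pi B) ×ˢ B t := by
      ext p
      simp only [Set.mem_preimage, Set.mem_pi, Finset.mem_coe, Set.mem_prod, Finset.mem_erase]
      constructor
      · intro h
        exact ⟨fun i hi => by simpa [Function.update_of_ne hi.1] using h i hi.2,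
          by simpa using h t hts⟩
      · rintro ⟨h1, h2⟩ i hi
        by_cases hit : i = t
        · subst hit; simpa using h2
        · simpa [Function.update_of_ne hit] using h1 i ⟨hit, hi⟩
    rw [h, Measure.prod_prod]
    unfold gameLaw
    rw [Measure.infinitePi_pi _ fun i _ => hB i, mul_comm, Finset.mul_prod_erase s (fun i => roundLaw P ν (B i)) hts]
  · have h : (fun p : Outcome K P × Round K P => Function.update p.1 t p.2) ⁻¹'
        ((s : Set ℕ).pi B) = ((s : Set ℕ).pi B) ×ˢ Set.univ := by
      ext p
      simp only [Set.mem_preimage, Set.mem_pi, Finset.mem_coe, Set.mem_prod, Set.mem_univ, and_true]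
      refine forall₂_congr fun i hi => ?_
      rw [Function.update_of_ne (by rintro rfl; exact hts hi)]
    rw [h, Measure.prod_prod, measure_univ, mul_one]
    exact Measure.infinitePi_pi _ fun i _ => hB i

/-- Fubini after resampling round `t`. It plays the role of conditioning on all other rounds. -/
theorem gameLaw_apply_update (t : ℕ) {A : Set (Outcome K P)} (hA : MeasurableSet A) :
    gameLaw P ν A =
      ∫⁻ ω, roundLaw P ν {x | Function.update ω t x ∈ A} ∂(gameLaw P ν) := by
  conv_lhs => rw [← gameLaw_map_update ν t, Measure.map_apply (measurable_update_prod t) hA]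
  rw [Measure.prod_apply (measurable_update_prod t hA)]
  rfl

/-- The exponential Markov inequality for a sum of a function over independent rounds. -/
theorem gameLaw_sum_nonneg_le (s : Finset ℕ) {h : Round K P → ℝ} (hm : Measurable h)
    (hi : Integrable (fun x => Real.exp (h x)) (roundLaw P ν)) :
    (gameLaw P ν).real {ω | 0 ≤ ∑ t ∈ s, h (ω t)} ≤
      (∫ x, Real.exp (h x) ∂(roundLaw P ν)) ^ s.card := by
  have hind : iIndepFun (fun t (ω : Outcome K P) => h (ω t)) (gameLaw P ν) :=
    iIndepFun_infinitePi fun _ => hm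
  have hmeas (t : ℕ) : Measurable fun ω : Outcome K P => h (ω t) :=
    hm.comp (measurable_pi_apply t)
  have hmp (t : ℕ) : MeasurePreserving (Function.eval t) (gameLaw P ν) (roundLaw P ν) :=
    measurePreserving_eval_infinitePi _ t
  have hint (t : ℕ) : Integrable (fun ω : Outcome K P => Real.exp (1 * h (ω t)))
      (gameLaw P ν) := by
    simpa [Function.comp_def] using (hmp t).integrable_comp_of_integrable hi
  have h1 := measure_ge_le_exp_mul_mgf (μ := gameLaw P ν)
    (X := ∑ t ∈ s, fun ω : Outcome K P => h (ω t)) (t := 1) 0 zero_le_one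
    (hind.integrable_exp_mul_sum hmeas fun t _ => hint t)
  rw [hind.mgf_sum hmeas] at h1
  have h2 (t : ℕ) : mgf (fun ω : Outcome K P => h (ω t)) (gameLaw P ν) 1 =
      ∫ x, Real.exp (h x) ∂(roundLaw P ν) := by
    simp only [mgf, one_mul]
    conv_rhs => rw [← (hmp t).map_eq]
    rw [integral_map (hmp t).measurable.aemeasurable (by
      rw [(hmp t).map_eq]; exact hi.aestronglyMeasurable)]
  simpa [h2] using h1

theorem coinLaw_fst (B : Finset (Fin K)) :
    coinLaw K {c | c.1 ∈ B} = (B.card : ENNReal) / K := by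
  have h (n : ℕ) [NeZero n] : IsProbabilityMeasure
      (uniformOn (Set.univ : Set (Fin n))) :=
    isProbabilityMeasure_uniformOn Set.finite_univ Set.univ_nonempty
  have h2 (n : Fin K) := h (n.val + 1)
  have : {c : Coin K | c.1 ∈ B} = (B : Set (Fin K)) ×ˢ Set.univ := by ext; simp
  rw [this, coinLaw, Measure.prod_prod, measure_univ, mul_one, uniformOn_univ]
  simp

theorem coinLaw_snd (n : Fin K) (B : Finset (Fin (n.val + 1))) :
    coinLaw K {c | c.2 n ∈ B} = (B.card : ENNReal) / (n.val + 1 : ℕ) := by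
  have h (n : ℕ) [NeZero n] : IsProbabilityMeasure
      (uniformOn (Set.univ : Set (Fin n))) :=
    isProbabilityMeasure_uniformOn Set.finite_univ Set.univ_nonempty
  have h1 := h K
  have h2 (n : Fin K) := h (n.val + 1)
  have : {c : Coin K | c.2 n ∈ B} = Set.univ ×ˢ (Function.eval n ⁻¹' (B : Set _)) := by
    ext; simp
  rw [this, coinLaw, Measure.prod_prod, measure_univ, one_mul,
    (measurePreserving_eval (fun n : Fin K =>
      uniformOn (Set.univ : Set (Fin (n.val + 1)))) n).measure_preimage
      (MeasurableSet.of_discrete).nullMeasurableSet, uniformOn_univ]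
  simp

end Probability

/-! ### Concentration inequalities for the learning phase -/

section Learning

/-- Hoeffding's bound on an exponential moment, with integrability. -/
theorem integrable_exp_and_integral_exp_le {Ω : Type*} [MeasurableSpace Ω] {ρ : Measure Ω}
    [IsProbabilityMeasure ρ] {X : Ω → ℝ} (hX : AEMeasurable X ρ)
    (hX01 : ∀ᵐ x ∂ρ, X x ∈ Set.Icc (0 : ℝ) 1) (l c : ℝ) :
    Integrable (fun x => Real.exp (l * (X x - ∫ y, X y ∂ρ) - c)) ρ ∧
      ∫ x, Real.exp (l * (X x - ∫ y, X y ∂ρ) - c) ∂ρ ≤ Real.exp (l ^ 2 / 8 - c) := by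
  -- The variance proxy is (1/2)² for an interval of length 1, whence the exponent l²/8.
  have h := hasSubgaussianMGF_of_mem_Icc hX hX01
  have h1 := h.mgf_le l
  have h2 := h.integrable_exp_mul l
  simp only [Real.exp_sub, div_eq_mul_inv] at *
  refine ⟨h2.mul_const _, ?_⟩
  rw [integral_mul_const]
  refine mul_le_mul_of_nonneg_right (h1.trans (le_of_eq ?_)) (by positivity)
  congr 1
  simp
  ring

/-- The worst case is n = K - 1 = m, where 1 - 1/(m+1) is the inverse of 1 + 1/m and (1 + 1/m)^m ≤
e. This bounds below the probability that fewer than K independent uniform draws all avoid one arm.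
-/
theorem exp_neg_one_le_pow {K n : ℕ} (hK : 0 < K) (hn : n < K) :
    Real.exp (-1) ≤ (1 - 1 / (K : ℝ)) ^ n := by
  obtain ⟨m, rfl⟩ : ∃ m, K = m + 1 := ⟨K - 1, by omega⟩
  have h0 : (0 : ℝ) ≤ 1 - 1 / ((m + 1 : ℕ) : ℝ) := by
    rw [sub_nonneg, div_le_one (by positivity)]
    push_cast
    linarith [(Nat.cast_nonneg m : (0 : ℝ) ≤ m)]
  have h1 : 1 - 1 / ((m + 1 : ℕ) : ℝ) ≤ 1 := by
    have : (0 : ℝ) ≤ 1 / ((m + 1 : ℕ) : ℝ) := by positivity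
    linarith
  refine le_trans ?_ (pow_le_pow_of_le_one h0 h1 (show n ≤ m by omega))
  rcases Nat.eq_zero_or_pos m with rfl | hm
  · simp
  have hm' : (0 : ℝ) < m := by exact_mod_cast hm
  have h2 : 1 - 1 / ((m + 1 : ℕ) : ℝ) = (1 + 1 / (m : ℝ))⁻¹ := by
    push_cast; field_simp; ring
  rw [h2, inv_pow, Real.exp_neg]
  refine inv_anti₀ (by positivity) ?_
  calc (1 + 1 / (m : ℝ)) ^ m ≤ Real.exp (1 / m) ^ m := by
        gcongr
        linarith [Real.add_one_le_exp (1 / (m : ℝ))]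
    _ = Real.exp 1 := by
        rw [← Real.exp_nat_mul]; congr 1; field_simp

/-- A relative error below `1 / (10 K)` of the collision frequency does not change the rounded
estimate of the number of players. -/
theorem round_log_div_log {K N : ℕ} (hK : 2 ≤ K) (hN : 1 ≤ N) (hNK : N ≤ K) {v : ℝ}
    (hv : |v - (1 - 1 / (K : ℝ)) ^ (N - 1)| < 1 / (10 * K)) :
    0 < v ∧ round (Real.log v / Real.log (1 - 1 / (K : ℝ)) + 1) = (N : ℤ) := by
  have hK0 : (2 : ℝ) ≤ K := by exact_mod_cast hK
  have hKpos : (0 : ℝ) < K := by linarith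
  set r : ℝ := 1 - 1 / (K : ℝ) with hr
  have hr1 : r ≤ 1 - 1 / (K : ℝ) := le_rfl
  have hKinv : 1 / (K : ℝ) ≤ 1 / 2 := by gcongr
  have hKinv0 : 0 < 1 / (K : ℝ) := by positivity
  have hr0 : 0 < r := by rw [hr]; linarith
  set q : ℝ := r ^ (N - 1) with hq
  have hq0 : Real.exp (-1) ≤ q := exp_neg_one_le_pow (by omega) (by omega)
  have he : (0.36 : ℝ) < Real.exp (-1) := by
    have := Real.exp_neg_one_gt_d9; linarith
  have hq1 : 0.36 < q := lt_of_lt_of_le he hq0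
  have hqpos : 0 < q := by linarith
  have hd : 1 / (10 * (K : ℝ)) = 0.1 * (1 / K) := by field_simp; norm_num
  rw [hd, abs_lt] at hv
  set u := 1 / (K : ℝ) with hu
  have hvpos : 0 < v := by linarith [hv.1]
  refine ⟨hvpos, ?_⟩
  -- The quotient of logarithms is N - 1 plus log(v/q)/log r. Here |log r| ≥ u, while q > 0.36 and
  -- |v - q| < 0.1 u with u ≤ 1/2 put both v/q and q/v below 1 + u/2; so the extra term is below 1/2
  -- in absolute value.
  have hlogr : Real.log r ≤ -u := by
    have := Real.log_le_sub_one_of_pos hr0; linarith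
  have hup : Real.log (v / q) < u / 2 := by
    have h1 := Real.log_le_sub_one_of_pos (div_pos hvpos hqpos)
    have h2 : v / q < 1 + u / 2 := by
      rw [div_lt_iff₀ hqpos]; nlinarith [hv.2]
    linarith
  have hlo : -(u / 2) < Real.log (v / q) := by
    have h1 := Real.log_le_sub_one_of_pos (div_pos hqpos hvpos)
    have h2 : q / v < 1 + u / 2 := by
      rw [div_lt_iff₀ hvpos]; nlinarith [hv.1]
    have h3 : Real.log (v / q) = -Real.log (q / v) := by
      rw [← Real.log_inv, inv_div]
    linarith
  have hlogv : Real.log v = (N - 1 : ℕ) * Real.log r + Real.log (v / q) := by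
    rw [Real.log_div hvpos.ne' hqpos.ne', hq, Real.log_pow]; ring
  have hlr : Real.log r < 0 := by linarith
  have hN1 : ((N - 1 : ℕ) : ℝ) = N - 1 := by push_cast [hN]; ring
  have hdiv : Real.log v / Real.log r + 1 = N + Real.log (v / q) / Real.log r := by
    rw [hlogv, hN1]; field_simp [hlr.ne]; ring
  rw [hdiv, round_eq, Int.floor_eq_iff]
  have e1 : Real.log (v / q) / Real.log r < 1 / 2 := by
    rw [div_lt_iff_of_neg hlr]; linarith
  have e2 : -(1 / 2) < Real.log (v / q) / Real.log r := by
    rw [lt_div_iff_of_neg hlr]; linarith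
  constructor <;> push_cast <;> linarith

variable {K : ℕ} {P : Type*} [DecidableEq P]

theorem prod_ite_card [Fintype P] {S : Finset P} {j : P} (hj : j ∈ S) (a b : ℝ) :
    ∏ i, (if i = j then a else if i ∈ S then b else 1) = a * b ^ (S.card - 1) := by
  have h1 : ∏ i, (if i = j then a else if i ∈ S then b else 1) =
      ∏ i ∈ S, (if i = j then a else if i ∈ S then b else 1) := by
    refine (Finset.prod_subset (Finset.subset_univ S) fun i _ hi => ?_).symm
    rw [if_neg (by rintro rfl; exact hi hj), if_neg hi]
  rw [h1, ← Finset.mul_prod_erase S _ hj, if_pos rfl]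
  congr 1
  rw [← Finset.card_erase_of_mem hj]
  refine Finset.prod_eq_pow_card fun i hi => ?_
  rw [if_neg (Finset.ne_of_mem_erase hi), if_pos (Finset.mem_of_mem_erase hi)]

variable [NeZero K] [Fintype P] (ν : Fin K → Measure ℝ) [∀ k, IsProbabilityMeasure (ν k)]

/-- The law of the coins of all players in one round. -/
noncomputable abbrev coinsLaw (K : ℕ) (P : Type*) [Fintype P] : Measure (P → Coin K) :=
  Measure.pi fun _ : P => coinLaw K

/-- The coins with which an exploring player `j` observes arm `k`. -/
def observing (S : Finset P) (j : P) (k : Fin K) : Set (P → Coin K) :=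
  {y | (y j).1 = k ∧ ¬ Collides S (fun i => (y i).1) j}

/-- The event is a box: `j` draws `k`, every other member of `S` draws something else, and the
remaining players are free. -/
theorem coinsLaw_observing {S : Finset P} {j : P} (hj : j ∈ S) (k : Fin K) :
    (coinsLaw K P).real (observing S j k) = 1 / K * (1 - 1 / (K : ℝ)) ^ (S.card - 1) := by
  have hK : 0 < K := NeZero.pos K
  have : observing S j k = Set.univ.pi fun i =>
      {c : Coin K | c.1 ∈ if i = j then {k} else if i ∈ S then ({k} : Finset (Fin K))ᶜ
        else Finset.univ} := by
    ext y
    simp only [observing, Collides, Set.mem_ofPred_eq, Set.mem_pi, Set.mem_univ, true_imp_iff,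
      not_exists, not_and]
    constructor
    · rintro ⟨h1, h2⟩ i
      split_ifs with hi hS
      · simp [hi, h1]
      · simpa [h1] using h2 i hS hi
      · simp
    · intro h
      have hj' : (y j).1 = k := by simpa using h j
      refine ⟨hj', fun i hi hij => ?_⟩
      have := h i
      rw [if_neg hij, if_pos hi] at this
      simpa [hj'] using this
  rw [measureReal_def, this, Measure.pi_pi, ENNReal.toReal_prod, ← prod_ite_card hj]
  refine Finset.prod_congr rfl fun i _ => ?_
  rw [coinLaw_fst]
  split_ifs
  · simp
  · rw [Finset.card_compl]
    simp only [Fintype.card_fin, Finset.card_singleton, ENNReal.toReal_div, ENNReal.toReal_natCast]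
    rw [Nat.cast_sub (by omega)]
    have : (K : ℝ) ≠ 0 := by positivity
    field_simp
    simp
  · simp

theorem coinsLaw_not_collides {S : Finset P} {j : P} (hj : j ∈ S) :
    (coinsLaw K P).real {y | ¬ Collides S (fun i => (y i).1) j} =
      (1 - 1 / (K : ℝ)) ^ (S.card - 1) := by
  have hK : (K : ℝ) ≠ 0 := NeZero.ne _
  have : {y : P → Coin K | ¬ Collides S (fun i => (y i).1) j} = ⋃ k, observing S j k := by
    ext y; simp [observing]
  rw [this, measureReal_iUnion_fintype]
  · simp only [coinsLaw_observing hj]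
    simp; field_simp
  · intro k l hkl
    refine Set.disjoint_left.mpr fun y hy hy' => hkl (hy.1.symm.trans hy'.1)
  · exact fun k => MeasurableSet.of_discrete

end Learning

section Learning

variable {K : ℕ} {P : Type*} [DecidableEq P]
variable [NeZero K] [Fintype P] (ν : Fin K → Measure ℝ) [∀ k, IsProbabilityMeasure (ν k)]

theorem integral_roundLaw_coins (f : (P → Coin K) → ℝ) :
    ∫ x, f x.2 ∂(roundLaw P ν) = ∫ y, f y ∂(coinsLaw K P) := by
  unfold roundLaw
  rw [integral_fun_snd (μ := Measure.pi ν) (ν := coinsLaw K P) f]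
  simp

/-- Hoeffding's inequality before `l` is optimised; the sign of `l` selects the tail. -/
theorem gameLaw_sum_dev_le (s : Finset ℕ) (A : Set (P → Coin K)) (l η : ℝ) :
    (gameLaw P ν).real {ω | 0 ≤ ∑ t ∈ s,
      (l * (A.indicator 1 (ω t).2 - (coinsLaw K P).real A) - η)} ≤
      Real.exp (l ^ 2 / 8 - η) ^ s.card := by
  have hA : MeasurableSet A := MeasurableSet.of_discrete
  have hm : Measurable fun x : Round K P => (A.indicator 1 x.2 : ℝ) :=
    (measurable_one.indicator hA).comp measurable_snd
  have hmean : ∫ x : Round K P, (A.indicator 1 x.2 : ℝ) ∂(roundLaw P ν) =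
      (coinsLaw K P).real A := by
    rw [integral_roundLaw_coins ν (fun y => (A.indicator 1 y : ℝ)), integral_indicator_one hA]
  have h := integrable_exp_and_integral_exp_le (ρ := roundLaw P ν) hm.aemeasurable
    (Filter.Eventually.of_forall fun x => by
      by_cases hx : x.2 ∈ A <;> simp [hx]) l η
  rw [hmean] at h
  refine (gameLaw_sum_nonneg_le ν s ?_ h.1).trans ?_
  · exact ((hm.sub_const _).const_mul _).sub_const _
  · exact pow_le_pow_left₀ (integral_nonneg fun _ => (Real.exp_pos _).le) h.2 _

variable {active : ℕ → Finset P} {T₀ T₁ m : ℕ} {S : Finset P} {j : P}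

theorem sum_indicator_not_collides (hS : ∀ t ∈ Finset.Ico (m * T₁) (m * T₁ + T₀), active t = S)
    (ω : Outcome K P) :
    ∑ t ∈ Finset.Ico (m * T₁) (m * T₁ + T₀),
      ({y : P → Coin K | ¬ Collides S (fun i => (y i).1) j}.indicator 1 (ω t).2 : ℝ) =
      T₀ - (collisionRounds active T₀ T₁ ω m j).card := by
  rw [eq_sub_iff_add_eq, collisionRounds, Finset.card_filter, Nat.cast_sum,
    ← Finset.sum_add_distrib]
  have : ∀ t ∈ Finset.Ico (m * T₁) (m * T₁ + T₀),
      ({y : P → Coin K | ¬ Collides S (fun i => (y i).1) j}.indicator 1 (ω t).2 : ℝ) +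
        ((if Collides (active t) (explore ω t) j then 1 else 0 : ℕ) : ℝ) = 1 := by
    intro t ht
    rw [hS t ht]
    by_cases h : Collides S (explore ω t) j
    · have h' : Collides S (fun i => ((ω t).2 i).1) j := h
      simp [h, h']
    · have h' : ¬ Collides S (fun i => ((ω t).2 i).1) j := h
      simp [h, h']
  rw [Finset.sum_congr rfl this]
  simp

theorem estimate_eq_card (hj : j ∈ S) (hSK : S.card ≤ K) (ω : Outcome K P)
    (h : K = 1 ∨ |((T₀ : ℝ) - (collisionRounds active T₀ T₁ ω m j).card) / T₀ -
      (1 - 1 / (K : ℝ)) ^ (S.card - 1)| < 1 / (10 * K)) :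
    estimate active T₀ T₁ ω m j = S.card := by
  have hS : 1 ≤ S.card := Finset.card_pos.mpr ⟨j, hj⟩
  have hK := NeZero.pos K
  rcases Nat.lt_or_ge K 2 with hK2 | hK2
  -- For one arm log(1 - 1/K) = log 0 = 0, and division by zero gives 0, so the rounding branch
  -- returns 1; the other branch returns K = 1.
  · obtain rfl : K = 1 := by omega
    have hS1 : S.card = 1 := by omega
    unfold estimate
    split_ifs <;> simp [hS1]
  have h := h.resolve_left (by omega)
  obtain ⟨h1, h2⟩ := round_log_div_log hK2 hS hSK h
  unfold estimate
  rw [if_neg]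
  · exact h2
  -- Colliding in all rounds would make the frequency 0, but `h1` says that it is positive.
  · intro hC
    rw [hC] at h1
    simp at h1

theorem gameLaw_estimate_ne_le (hT₀ : 0 < T₀) (hj : j ∈ S) (hSK : S.card ≤ K)
    (hS : ∀ t ∈ Finset.Ico (m * T₁) (m * T₁ + T₀), active t = S) :
    (gameLaw P ν).real {ω | estimate active T₀ T₁ ω m j ≠ S.card} ≤
      2 * Real.exp (-(T₀ * 0.02 / (K : ℝ) ^ 2)) := by
  have hK : (0 : ℝ) < K := by exact_mod_cast NeZero.pos K
  set A : Set (P → Coin K) := {y | ¬ Collides S (fun i => (y i).1) j} with hA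
  set I := Finset.Ico (m * T₁) (m * T₁ + T₀) with hI
  set η : ℝ := 1 / (10 * K) with hη
  have hη0 : 0 < η := by positivity
  have hIc : I.card = T₀ := by simp [hI]
  have hT : (0 : ℝ) < T₀ := by exact_mod_cast hT₀
  -- A mean deviation of η corresponds to l = ±4η with slack 4η², the optimal choice. The exponent
  -- per round is 2η² - 4η² = -2η² = -0.02/K², the source of the constant 0.02 in T₀.
  have key (l : ℝ) (hl : l ^ 2 = (4 * η) ^ 2) : (gameLaw P ν).real {ω | 0 ≤ ∑ t ∈ I,
      (l * (A.indicator 1 (ω t).2 - (coinsLaw K P).real A) - 4 * η ^ 2)} ≤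
      Real.exp (-(T₀ * 0.02 / (K : ℝ) ^ 2)) := by
    refine (gameLaw_sum_dev_le ν I A l (4 * η ^ 2)).trans (le_of_eq ?_)
    rw [hIc, ← Real.exp_nat_mul, hl, hη]
    congr 1
    field_simp
    norm_num
  have hsub : {ω | estimate active T₀ T₁ ω m j ≠ S.card} ⊆
      {ω | 0 ≤ ∑ t ∈ I,
        ((4 * η) * (A.indicator 1 (ω t).2 - (coinsLaw K P).real A) - 4 * η ^ 2)} ∪
      {ω | 0 ≤ ∑ t ∈ I,
        ((-(4 * η)) * (A.indicator 1 (ω t).2 - (coinsLaw K P).real A) - 4 * η ^ 2)} := by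
    intro ω hω
    by_contra hcon
    simp only [Set.mem_union, Set.mem_ofPred_eq, not_or, not_le, Finset.sum_sub_distrib,
      ← Finset.mul_sum, Finset.sum_const, hIc, nsmul_eq_mul] at hcon
    rw [hA, hI, sum_indicator_not_collides hS ω, coinsLaw_not_collides hj] at hcon
    refine hω (estimate_eq_card hj hSK ω (Or.inr ?_))
    rw [← hη]
    set C : ℝ := ((collisionRounds active T₀ T₁ ω m j).card : ℝ)
    set q := (1 - 1 / (K : ℝ)) ^ (S.card - 1)
    have : (T₀ - C) / T₀ - q = (T₀ - C - T₀ * q) / T₀ := by field_simp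
    rw [this, abs_lt, lt_div_iff₀ hT, div_lt_iff₀ hT]
    constructor
    · nlinarith [hcon.2]
    · nlinarith [hcon.1]
  refine (measureReal_mono hsub).trans ((measureReal_union_le _ _).trans ?_)
  have h1 := key (4 * η) rfl
  have h2 := key (-(4 * η)) (by ring)
  linarith

/-- The centred contribution of one round to the deviation of an empirical mean. -/
noncomputable def rewardDeviation (A : Set (P → Coin K)) (k : Fin K) (l c : ℝ) (x : Round K P) :
    ℝ :=
  A.indicator 1 x.2 * (l * (x.1 k - mean ν k) - c)

/-- The number of observations is random, but no conditioning on it is needed: a round without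
observation contributes the factor 1. Coins and rewards are independent, so with p the probability
of observing, the exponential moment of a round is at most 1 - p + p exp(l²/8 - c), and 1 + x ≤ exp
x finishes. -/
theorem gameLaw_sum_rewardDeviation_le (hν : ∀ k, ∀ᵐ x ∂(ν k), x ∈ Set.Icc (0 : ℝ) 1)
    (s : Finset ℕ) (A : Set (P → Coin K)) (k : Fin K) (l c : ℝ) :
    (gameLaw P ν).real {ω | 0 ≤ ∑ t ∈ s, rewardDeviation ν A k l c (ω t)} ≤
      Real.exp (-((coinsLaw K P).real A * (1 - Real.exp (l ^ 2 / 8 - c)))) ^ s.card := by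
  have hA : MeasurableSet A := MeasurableSet.of_discrete
  have hm : Measurable fun x : Round K P => (A.indicator 1 x.2 : ℝ) :=
    (measurable_one.indicator hA).comp measurable_snd
  have hmk : Measurable fun x : Round K P => x.1 k :=
    (measurable_pi_apply k).comp measurable_fst
  have hmd : Measurable (rewardDeviation (P := P) ν A k l c) :=
    hm.mul (((hmk.sub_const _).const_mul _).sub_const _)
  obtain ⟨h1, h2⟩ := integrable_exp_and_integral_exp_le (ρ := ν k) measurable_id.aemeasurable
    (hν k) l c
  simp only [id] at h1 h2
  set g : ℝ → ℝ := fun y => Real.exp (l * (y - mean ν k) - c) with hg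
  have hmp : MeasurePreserving (Function.eval k) (Measure.pi ν) (ν k) :=
    measurePreserving_eval ν k
  have hg1 : Integrable (fun z : Fin K → ℝ => g (z k)) (Measure.pi ν) := by
    exact hmp.integrable_comp_of_integrable h1
  have hg2 : ∫ z, g (z k) ∂(Measure.pi ν) = ∫ y, g y ∂(ν k) := by
    conv_rhs => rw [← hmp.map_eq]
    rw [integral_map hmp.measurable.aemeasurable (by
      rw [hmp.map_eq]; exact h1.aestronglyMeasurable)]
  have hexp : (fun x : Round K P => Real.exp (rewardDeviation ν A k l c x)) =
      fun x => (1 - A.indicator 1 x.2) + g (x.1 k) * A.indicator 1 x.2 := by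
    funext x
    by_cases hx : x.2 ∈ A <;> simp [rewardDeviation, hx, hg]
  have hi1 : Integrable (fun y : P → Coin K => (A.indicator 1 y : ℝ)) (coinsLaw K P) :=
    (integrable_const (1 : ℝ)).indicator hA
  have hi2 : Integrable (fun x : Round K P => g (x.1 k) * A.indicator 1 x.2) (roundLaw P ν) :=
    hg1.mul_prod hi1
  have hi3 : Integrable (fun x : Round K P => (1 - A.indicator 1 x.2 : ℝ)) (roundLaw P ν) :=
    (integrable_const _).sub (hi1.comp_snd _)
  have hint : Integrable (fun x => Real.exp (rewardDeviation ν A k l c x)) (roundLaw P ν) := by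
    rw [hexp]; exact hi3.add hi2
  refine (gameLaw_sum_nonneg_le ν s hmd hint).trans ?_
  refine pow_le_pow_left₀ (integral_nonneg fun _ => (Real.exp_pos _).le) ?_ _
  have hval : ∫ x, Real.exp (rewardDeviation ν A k l c x) ∂(roundLaw P ν) =
      1 - (coinsLaw K P).real A + (∫ y, g y ∂(ν k)) * (coinsLaw K P).real A := by
    rw [hexp, integral_add hi3 hi2]
    congr 1
    · rw [integral_roundLaw_coins ν (fun y => (1 - A.indicator 1 y : ℝ)),
        integral_sub (integrable_const _) hi1, integral_indicator_one hA]
      simp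
    · unfold roundLaw
      rw [integral_prod_mul (fun z : Fin K → ℝ => g (z k))
        (fun y : P → Coin K => (A.indicator 1 y : ℝ)), hg2]
      rw [integral_indicator_one hA]
  rw [hval]
  have hp : 0 ≤ (coinsLaw K P).real A := measureReal_nonneg
  have h3 : (∫ y, g y ∂(ν k)) ≤ Real.exp (l ^ 2 / 8 - c) := h2
  calc 1 - (coinsLaw K P).real A + (∫ y, g y ∂(ν k)) * (coinsLaw K P).real A
      ≤ -((coinsLaw K P).real A * (1 - Real.exp (l ^ 2 / 8 - c))) + 1 := by nlinarith
    _ ≤ _ := Real.add_one_le_exp _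

theorem sum_rewardDeviation (hS : ∀ t ∈ Finset.Ico (m * T₁) (m * T₁ + T₀), active t = S)
    (k : Fin K) (l c : ℝ) (ω : Outcome K P) :
    ∑ t ∈ Finset.Ico (m * T₁) (m * T₁ + T₀), rewardDeviation ν (observing S j k) k l c (ω t) =
      l * (∑ t ∈ observationRounds active T₀ T₁ ω m j k, (ω t).1 k) -
        (observationRounds active T₀ T₁ ω m j k).card * (l * mean ν k + c) := by
  have h1 : l * (∑ t ∈ observationRounds active T₀ T₁ ω m j k, (ω t).1 k) -
        (observationRounds active T₀ T₁ ω m j k).card * (l * mean ν k + c) =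
      ∑ t ∈ observationRounds active T₀ T₁ ω m j k, (l * ((ω t).1 k - mean ν k) - c) := by
    simp only [Finset.sum_sub_distrib, ← Finset.mul_sum, Finset.sum_const, nsmul_eq_mul]
    ring
  rw [h1, observationRounds, Finset.sum_filter]
  refine Finset.sum_congr rfl fun t ht => ?_
  rw [hS t ht]
  by_cases h : explore ω t j = k ∧ ¬ Collides S (explore ω t) j
  · have h' : (ω t).2 ∈ observing S j k := h
    rw [if_pos h]
    simp [rewardDeviation, h']
  · have h' : (ω t).2 ∉ observing S j k := h
    rw [if_neg h]
    simp [rewardDeviation, h']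

/-- Two errors below ε/2 cannot reverse a gap larger than ε. -/
theorem IsSorting.isCorrectRanking {srt : (Fin K → ℝ) → Equiv.Perm (Fin K)} (hsrt : IsSorting srt)
    {ε : ℝ} {v : Fin K → ℝ} (hv : ∀ k, |v k - mean ν k| < ε / 2) :
    IsCorrectRanking ν ε (srt v) := by
  intro a b hab
  by_contra hcon
  have h := hsrt.antitone v (not_lt.mp hcon)
  simp only [Function.comp, Equiv.apply_symm_apply] at h
  have h1 := abs_lt.mp (hv a)
  have h2 := abs_lt.mp (hv b)
  linarith [h1.1, h2.2]

theorem gameLaw_not_isCorrectRanking_le (hν : ∀ k, ∀ᵐ x ∂(ν k), x ∈ Set.Icc (0 : ℝ) 1)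
    {srt : (Fin K → ℝ) → Equiv.Perm (Fin K)} (hsrt : IsSorting srt)
    {ε : ℝ} (hε : 0 < ε) (hε1 : ε ≤ 1) (hj : j ∈ S) (hSK : S.card ≤ K)
    (hS : ∀ t ∈ Finset.Ico (m * T₁) (m * T₁ + T₀), active t = S) :
    (gameLaw P ν).real {ω | ¬ IsCorrectRanking ν ε (ranking srt active T₀ T₁ ω m j)} ≤
      2 * K * Real.exp (-(T₀ * ε ^ 2 / (16 * K))) := by
  have hK : (0 : ℝ) < K := by exact_mod_cast NeZero.pos K
  set I := Finset.Ico (m * T₁) (m * T₁ + T₀) with hI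
  have hIc : I.card = T₀ := by simp [hI]
  let bad (l : ℝ) (k : Fin K) : Set (Outcome K P) :=
    {ω | 0 ≤ ∑ t ∈ I, rewardDeviation ν (observing S j k) k l (ε ^ 2) (ω t)}
  -- The tolerated error is c/|l| = ε²/(2ε) = ε/2. Then l²/8 - c = -ε²/2, and 1 - exp(-ε²/2) ≥ ε²/4
  -- because ε ≤ 1. The probability of observing is at least 0.25/K, which gives the exponent
  -- ε²/(16K) per round.
  have key (l : ℝ) (hl : l ^ 2 = (2 * ε) ^ 2) (k : Fin K) : (gameLaw P ν).real (bad l k) ≤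
      Real.exp (-(T₀ * ε ^ 2 / (16 * K))) := by
    refine (gameLaw_sum_rewardDeviation_le ν hν I (observing S j k) k l (ε ^ 2)).trans ?_
    rw [hIc, ← Real.exp_nat_mul, Real.exp_le_exp, coinsLaw_observing hj, hl]
    have h1 : Real.exp (-1) ≤ (1 - 1 / (K : ℝ)) ^ (S.card - 1) :=
      exp_neg_one_le_pow (NeZero.pos K)
        (by have := Finset.card_pos.mpr ⟨j, hj⟩; omega)
    have he : (0.36 : ℝ) < Real.exp (-1) := by
      have := Real.exp_neg_one_gt_d9; linarith
    have hx : (2 * ε) ^ 2 / 8 - ε ^ 2 = -(ε ^ 2 / 2) := by ring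
    rw [hx]
    have h2 : ε ^ 2 / 4 ≤ 1 - Real.exp (-(ε ^ 2 / 2)) := by
      have h3 : Real.exp (-(ε ^ 2 / 2)) ≤ (1 + ε ^ 2 / 2)⁻¹ := by
        rw [Real.exp_neg]
        exact inv_anti₀ (by positivity) (by linarith [Real.add_one_le_exp (ε ^ 2 / 2)])
      have h4 : (1 + ε ^ 2 / 2)⁻¹ ≤ 1 - ε ^ 2 / 4 := by
        rw [inv_le_iff_one_le_mul₀ (by positivity)]
        nlinarith [pow_le_one₀ hε.le hε1 (n := 2), sq_nonneg ε]
      linarith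
    have h5 : (ε ^ 2 / (16 * K) : ℝ) ≤
        1 / K * (1 - 1 / (K : ℝ)) ^ (S.card - 1) * (1 - Real.exp (-(ε ^ 2 / 2))) := by
      calc (ε ^ 2 / (16 * K) : ℝ) = 1 / K * 0.25 * (ε ^ 2 / 4) := by field_simp; norm_num
        _ ≤ _ := by
          gcongr
          · exact mul_nonneg (by positivity) ((Real.exp_pos _).le.trans h1)
          · linarith
    have h6 := mul_le_mul_of_nonneg_left h5 (Nat.cast_nonneg T₀ : (0 : ℝ) ≤ T₀)
    rw [mul_neg, neg_le_neg_iff]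
    calc _ = T₀ * (ε ^ 2 / (16 * K) : ℝ) := by ring
      _ ≤ _ := h6
  have hsub : {ω | ¬ IsCorrectRanking ν ε (ranking srt active T₀ T₁ ω m j)} ⊆
      ⋃ k, (bad (2 * ε) k ∪ bad (-(2 * ε)) k) := by
    intro ω hω
    by_contra hcon
    simp only [Set.mem_iUnion, not_exists, Set.mem_union, not_or, bad, Set.mem_ofPred_eq,
      not_le, hI, sum_rewardDeviation ν hS] at hcon
    refine hω (hsrt.isCorrectRanking ν fun k => ?_)
    obtain ⟨h1, h2⟩ := hcon k
    unfold empiricalMean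
    set n : ℝ := ((observationRounds active T₀ T₁ ω m j k).card : ℝ) with hn
    set Y := ∑ t ∈ observationRounds active T₀ T₁ ω m j k, (ω t).1 k with hY
    -- Without observations the sum is 0 and the outcome is bad by definition, so the default
    -- empirical mean 0 of an unobserved arm does no harm.
    have hn0 : 0 < n := by
      rcases (Nat.cast_nonneg _ : (0 : ℝ) ≤ n).lt_or_eq with h | h
      · exact h
      · have : observationRounds active T₀ T₁ ω m j k = ∅ := by
          have h' := h.symm
          rw [Nat.cast_eq_zero, Finset.card_eq_zero] at h'
          exact h'
        rw [hY, hn, this] at h1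
        simp at h1
    have hdiv : Y / n - mean ν k = (Y - n * mean ν k) / n := by field_simp
    rw [hdiv, abs_lt, lt_div_iff₀ hn0, div_lt_iff₀ hn0]
    constructor <;> nlinarith
  calc _ ≤ (gameLaw P ν).real (⋃ k, (bad (2 * ε) k ∪ bad (-(2 * ε)) k)) := measureReal_mono hsub
    _ ≤ ∑ k, (gameLaw P ν).real (bad (2 * ε) k ∪ bad (-(2 * ε)) k) :=
        measureReal_iUnion_fintype_le _
    _ ≤ ∑ _k : Fin K, 2 * Real.exp (-(T₀ * ε ^ 2 / (16 * K))) := by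
        refine Finset.sum_le_sum fun k _ => (measureReal_union_le _ _).trans ?_
        have h1 := key (2 * ε) rfl k
        have h2 := key (-(2 * ε)) (by ring) k
        linarith
    _ = _ := by simp; ring

end Learning

/-! ### Dependence of lists, estimates and choices on the randomness of single rounds -/

section Dynamics

theorem div_mod_of_mem_Ico {m t T₁ : ℕ} (h : t ∈ Set.Ico (m * T₁) ((m + 1) * T₁)) :
    t / T₁ = m ∧ t % T₁ = t - m * T₁ := by
  have h1 : t / T₁ = m := Nat.div_eq_of_lt_le h.1 h.2
  have h2 := Nat.div_add_mod t T₁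
  rw [h1, mul_comm] at h2
  exact ⟨h1, by omega⟩

theorem notMem_learning {m t T₀ T₁ : ℕ} (hT₁ : T₀ < T₁) (ht : T₀ ≤ t % T₁) :
    t ∉ Finset.Ico (m * T₁) (m * T₁ + T₀) := by
  intro h
  rw [Finset.mem_Ico] at h
  have := (div_mod_of_mem_Ico (m := m) (T₁ := T₁) (t := t) ⟨h.1, by rw [add_mul]; omega⟩).2
  omega

variable {K : ℕ} {P : Type*} [DecidableEq P] {active : ℕ → Finset P} {T₀ T₁ : ℕ}
  {srt : (Fin K → ℝ) → Equiv.Perm (Fin K)}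

section Congr

variable {ω ω' : Outcome K P} {m : ℕ}
  (h : ∀ t ∈ Finset.Ico (m * T₁) (m * T₁ + T₀), ω t = ω' t)
include h

theorem estimate_congr : estimate active T₀ T₁ ω m = estimate active T₀ T₁ ω' m := by
  funext j
  have : collisionRounds active T₀ T₁ ω m j = collisionRounds active T₀ T₁ ω' m j := by
    refine Finset.filter_congr fun t ht => ?_
    have : explore ω t = explore ω' t := by funext i; simp [explore, h t ht]
    rw [this]
  simp only [estimate, this]

theorem ranking_congr : ranking srt active T₀ T₁ ω m = ranking srt active T₀ T₁ ω' m := by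
  funext j
  have h1 (k : Fin K) :
      observationRounds active T₀ T₁ ω m j k = observationRounds active T₀ T₁ ω' m j k := by
    refine Finset.filter_congr fun t ht => ?_
    have : explore ω t = explore ω' t := by funext i; simp [explore, h t ht]
    rw [this]
  unfold ranking
  congr 1
  funext k
  unfold empiricalMean
  rw [h1]
  congr 1
  refine Finset.sum_congr rfl fun t ht => ?_
  rw [h t (Finset.mem_filter.mp ht).1]

end Congr

section Update

variable {t : ℕ} (hT₁ : T₀ < T₁) (ht : T₀ ≤ t % T₁) (ω : Outcome K P) (x : Round K P)
include hT₁ ht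

theorem ranking_update (m : ℕ) : ranking srt active T₀ T₁ (Function.update ω t x) m =
    ranking srt active T₀ T₁ ω m := by
  refine ranking_congr fun s hs => Function.update_of_ne ?_ _ _
  rintro rfl
  exact notMem_learning hT₁ ht hs

theorem estimate_update (m : ℕ) : estimate active T₀ T₁ (Function.update ω t x) m =
    estimate active T₀ T₁ ω m := by
  refine estimate_congr fun s hs => Function.update_of_ne ?_ _ _
  rintro rfl
  exact notMem_learning hT₁ ht hs

/-- The good event, for all epochs at once, is determined by learning rounds. So conditioning on it
does not bias the coins of Musical Chairs rounds. -/
theorem update_mem_goodEvent_iff (ν : Fin K → Measure ℝ) (T : ℕ) (ε : ℝ) :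
    Function.update ω t x ∈ goodEvent ν srt active T T₀ T₁ ε ↔
      ω ∈ goodEvent ν srt active T T₀ T₁ ε := by
  simp only [goodEvent, Set.mem_ofPred_eq, ranking_update hT₁ ht, estimate_update hT₁ ht]

end Update

variable [NeZero K]

/-- The position up to which (inclusively) a player with estimate `n` draws from her list. -/
def lastPosition (K : ℕ) [NeZero K] (n : ℤ) : Fin K :=
  ⟨min n.toNat K - 1, by
    have := NeZero.pos K
    omega⟩

/-- The arms chosen in round `t` by players with lists `r`, estimates `e`, coins `y`, and fixed
arms `φ`. -/
noncomputable def choices (active : ℕ → Finset P) (T₀ T₁ t : ℕ) (r : P → Equiv.Perm (Fin K))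
    (e : P → ℤ) (y : P → Coin K) (φ : P → Option (Fin K)) (j : P) : Fin K :=
  if InChairs active T₀ T₁ t j then
    (φ j).getD (r j (Fin.castLE (lastPosition K (e j)).isLt ((y j).2 (lastPosition K (e j)))))
  else (y j).1

/-- The fixed arms after round `t`, if the arms `a` are chosen. -/
def fixStep (active : ℕ → Finset P) (T₀ T₁ t : ℕ) (φ : P → Option (Fin K)) (a : P → Fin K)
    (j : P) : Option (Fin K) :=
  if (t + 1) % T₁ = 0 then none
  else if φ j = none ∧ InChairs active T₀ T₁ t j ∧ ¬ Collides (active t) a j then some (a j)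
  else φ j

theorem fixedArm_succ (ω : Outcome K P) (t : ℕ) :
    fixedArm srt active T₀ T₁ ω (t + 1) =
      fixStep active T₀ T₁ t (fixedArm srt active T₀ T₁ ω t) (arm srt active T₀ T₁ ω t) := by
  funext j
  rw [fixedArm]
  rfl

/-- This exhibits the choice as a function of discrete data in which the coins of round `t` are a
separate argument, as both resampling and measurability require. -/
theorem arm_eq_choices (ω : Outcome K P) (t : ℕ) :
    arm srt active T₀ T₁ ω t = choices active T₀ T₁ t
      (ranking srt active T₀ T₁ ω (t / T₁)) (estimate active T₀ T₁ ω (t / T₁)) (ω t).2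
      (fixedArm srt active T₀ T₁ ω t) := rfl

theorem fixedArm_update {t : ℕ} (hT₁ : T₀ < T₁) (ht : T₀ ≤ t % T₁) (ω : Outcome K P)
    (x : Round K P) {s : ℕ} (hs : s ≤ t) :
    fixedArm srt active T₀ T₁ (Function.update ω t x) s = fixedArm srt active T₀ T₁ ω s := by
  induction s with
  | zero => rfl
  | succ s ih =>
    rw [fixedArm_succ, fixedArm_succ, arm_eq_choices, arm_eq_choices, ih (by omega),
      ranking_update hT₁ ht, estimate_update hT₁ ht, Function.update_of_ne (by omega)]

theorem arm_update {t : ℕ} (hT₁ : T₀ < T₁) (ht : T₀ ≤ t % T₁) (ω : Outcome K P)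
    (x : Round K P) :
    arm srt active T₀ T₁ (Function.update ω t x) t = choices active T₀ T₁ t
      (ranking srt active T₀ T₁ ω (t / T₁)) (estimate active T₀ T₁ ω (t / T₁)) x.2
      (fixedArm srt active T₀ T₁ ω t) := by
  rw [arm_eq_choices, fixedArm_update hT₁ ht ω x le_rfl, ranking_update hT₁ ht,
    estimate_update hT₁ ht, Function.update_self]

end Dynamics

/-! ### Measurability of the algorithm -/

section Measurability

variable {K : ℕ} {P : Type*} [DecidableEq P] {active : ℕ → Finset P} {T₀ T₁ : ℕ}
  {srt : (Fin K → ℝ) → Equiv.Perm (Fin K)}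

local instance instMeasurableSpacePermFin : MeasurableSpace (Equiv.Perm (Fin K)) := ⊤

local instance instMeasurableSpaceOptionFin : MeasurableSpace (Option (Fin K)) := ⊤

local instance : DiscreteMeasurableSpace (Equiv.Perm (Fin K)) := ⟨fun _ => trivial⟩

local instance : DiscreteMeasurableSpace (Option (Fin K)) := ⟨fun _ => trivial⟩

variable [Fintype P]

theorem measurable_coins (t : ℕ) : Measurable fun ω : Outcome K P => (ω t).2 :=
  measurable_snd.comp (measurable_pi_apply t)

theorem measurable_estimate (m : ℕ) :
    Measurable fun ω : Outcome K P => estimate active T₀ T₁ ω m := by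
  refine measurable_pi_iff.mpr fun j => ?_
  have h : Measurable fun ω : Outcome K P => (collisionRounds active T₀ T₁ ω m j).card := by
    simp only [collisionRounds, Finset.card_filter]
    refine Finset.measurable_sum _ fun t _ => ?_
    exact (Measurable.of_discrete (f := fun y : P → Coin K =>
      if Collides (active t) (fun i => (y i).1) j then 1 else 0)).comp (measurable_coins t)
  exact (Measurable.of_discrete (f := fun c : ℕ => if c = T₀ then (K : ℤ)
    else round (Real.log (((T₀ : ℝ) - c) / T₀) / Real.log (1 - 1 / (K : ℝ)) + 1))).comp h

/-- The only place where real-valued data influence the players; hence the condition on level sets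
in `IsSorting`. -/
theorem measurable_ranking (hsrt : IsSorting srt) (m : ℕ) :
    Measurable fun ω : Outcome K P => ranking srt active T₀ T₁ ω m := by
  refine measurable_pi_iff.mpr fun j => ?_
  have hset (t : ℕ) (k : Fin K) : MeasurableSet
      {ω : Outcome K P | explore ω t j = k ∧ ¬ Collides (active t) (explore ω t) j} :=
    measurable_coins t (MeasurableSet.of_discrete (s := observing (active t) j k))
  have h : Measurable fun ω : Outcome K P => empiricalMean active T₀ T₁ ω m j := by
    refine measurable_pi_iff.mpr fun k => ?_
    unfold empiricalMean
    simp only [observationRounds, Finset.card_filter, Finset.sum_filter, Nat.cast_sum]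
    refine Measurable.div (Finset.measurable_sum _ fun t _ => ?_)
      (Finset.measurable_sum _ fun t _ => ?_)
    · exact Measurable.ite (hset t k) ((measurable_pi_apply k).comp
        (measurable_fst.comp (measurable_pi_apply t))) measurable_const
    · simp only [Nat.cast_ite]
      exact Measurable.ite (hset t k) measurable_const measurable_const
  refine measurable_to_countable' fun σ => ?_
  exact h (hsrt.measurable σ)

theorem measurableSet_goodEvent (hsrt : IsSorting srt) (ν : Fin K → Measure ℝ) (T : ℕ) (ε : ℝ) :
    MeasurableSet (goodEvent ν srt active T T₀ T₁ ε) := by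
  have : goodEvent ν srt active T T₀ T₁ ε = ⋂ m, ⋂ (_ : m * T₁ + T₀ ≤ T),
      ((fun ω => ranking srt active T₀ T₁ ω m) ⁻¹'
        {r | ∀ j ∈ active (m * T₁), IsCorrectRanking ν ε (r j)} ∩
      (fun ω => estimate active T₀ T₁ ω m) ⁻¹'
        {e | ∀ j ∈ active (m * T₁), e j = (active (m * T₁)).card}) := by
    ext ω
    simp only [goodEvent, Set.mem_ofPred_eq, Set.mem_iInter, Set.mem_inter_iff, Set.mem_preimage]
    exact forall₂_congr fun m _ => forall₂_and
  rw [this]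
  refine MeasurableSet.iInter fun m => MeasurableSet.iInter fun _ => MeasurableSet.inter ?_ ?_
  · exact measurable_ranking hsrt m MeasurableSet.of_discrete
  · exact measurable_estimate m MeasurableSet.of_discrete

variable [NeZero K]

theorem measurable_arm_of_fixedArm (hsrt : IsSorting srt) {t : ℕ}
    (h : Measurable fun ω : Outcome K P => fixedArm srt active T₀ T₁ ω t) :
    Measurable fun ω : Outcome K P => arm srt active T₀ T₁ ω t :=
  (Measurable.of_discrete (f := fun p : (P → Equiv.Perm (Fin K)) × (P → ℤ) × (P → Coin K) ×
    (P → Option (Fin K)) => choices active T₀ T₁ t p.1 p.2.1 p.2.2.1 p.2.2.2)).comp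
    ((measurable_ranking hsrt (t / T₁)).prodMk ((measurable_estimate (t / T₁)).prodMk
      ((measurable_coins t).prodMk h)))

theorem measurable_fixedArm (hsrt : IsSorting srt) (t : ℕ) :
    Measurable fun ω : Outcome K P => fixedArm srt active T₀ T₁ ω t := by
  induction t with
  | zero => exact measurable_const
  | succ t ih =>
    simp only [fixedArm_succ]
    exact (Measurable.of_discrete (f := fun p : (P → Option (Fin K)) × (P → Fin K) =>
      fixStep active T₀ T₁ t p.1 p.2)).comp (ih.prodMk (measurable_arm_of_fixedArm hsrt ih))

theorem measurable_arm (hsrt : IsSorting srt) (t : ℕ) :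
    Measurable fun ω : Outcome K P => arm srt active T₀ T₁ ω t :=
  measurable_arm_of_fixedArm hsrt (measurable_fixedArm hsrt t)

theorem measurableSet_unfixed (hsrt : IsSorting srt) (t : ℕ) (j : P) :
    MeasurableSet {ω : Outcome K P | fixedArm srt active T₀ T₁ ω t j = none} :=
  measurable_fixedArm hsrt t (MeasurableSet.of_discrete (s := {φ : P → Option (Fin K) | φ j = none}))

theorem measurable_regret (hsrt : IsSorting srt) (ν : Fin K → Measure ℝ) (T : ℕ) :
    Measurable (regret (P := P) ν srt active T T₀ T₁) := by
  unfold regret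
  refine Finset.measurable_sum _ fun t _ => ?_
  exact (Measurable.of_discrete (f := fun a : P → Fin K => topSum ν (active t).card -
    ∑ j ∈ active t, if Collides (active t) a j then 0 else mean ν (a j))).comp
    (measurable_arm hsrt t)

theorem measurable_fixTime (hsrt : IsSorting srt) (T m : ℕ) (j : P) :
    Measurable (fixTime srt active T T₀ T₁ m j) := by
  unfold fixTime
  simp only [Finset.card_filter, Nat.cast_sum, Nat.cast_ite]
  refine Finset.measurable_sum _ fun t _ => Measurable.ite ?_ measurable_const measurable_const
  by_cases h : t / T₁ = m ∧ InChairs active T₀ T₁ t j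
  · simpa [h] using measurableSet_unfixed hsrt t j
  · have : {ω : Outcome K P | t / T₁ = m ∧ InChairs active T₀ T₁ t j ∧
        fixedArm srt active T₀ T₁ ω t j = none} = ∅ := by
      ext ω
      simp only [Set.mem_ofPred_eq, Set.mem_empty_iff_false, iff_false]
      exact fun h' => h ⟨h'.1, h'.2.1⟩
    rw [this]
    exact MeasurableSet.empty

end Measurability

/-! ### Probability of the good event -/

section GoodEvent

variable {K : ℕ} {P : Type*} [DecidableEq P] {active : ℕ → Finset P} {T T₀ T₁ Nm : ℕ}
  {srt : (Fin K → ℝ) → Equiv.Perm (Fin K)} {ν : Fin K → Measure ℝ}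

theorem active_eq_of_mem_learning (hT₁ : T₀ < T₁)
    (hactive : ∀ t, t + 1 < T → (t + 1) % T₁ ≠ 0 → (t + 1) % T₁ < T₀ →
      active (t + 1) = active t) {m : ℕ} (hm : m * T₁ + T₀ ≤ T) :
    ∀ t ∈ Finset.Ico (m * T₁) (m * T₁ + T₀), active t = active (m * T₁) := by
  intro t ht
  rw [Finset.mem_Ico] at ht
  obtain ⟨h1, h2⟩ := ht
  induction t, h1 using Nat.le_induction with
  | base => rfl
  | succ t h1 ih =>
    have h3 := (div_mod_of_mem_Ico (m := m) (T₁ := T₁) (t := t + 1)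
      ⟨by omega, by rw [add_mul]; omega⟩).2
    rw [hactive t (by omega) (by omega) (by omega), ih (by omega)]

theorem mean_mem_Icc [∀ k, IsProbabilityMeasure (ν k)]
    (hν : ∀ k, ∀ᵐ x ∂(ν k), x ∈ Set.Icc (0 : ℝ) 1) (k : Fin K) :
    mean ν k ∈ Set.Icc (0 : ℝ) 1 := by
  have hi : Integrable (fun x : ℝ => x) (ν k) := by
    refine Integrable.of_bound measurable_id.aestronglyMeasurable 1 ?_
    filter_upwards [hν k] with x hx
    simpa [abs_of_nonneg hx.1] using hx.2
  constructor
  · exact integral_nonneg_of_ae ((hν k).mono fun x hx => hx.1)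
  · have := integral_mono_ae hi (integrable_const (1 : ℝ)) ((hν k).mono fun x hx => hx.2)
    simpa [mean] using this

/-- Supplies the bound ε ≤ 1 used in the tail estimate for rankings. -/
theorem gap_le_one [∀ k, IsProbabilityMeasure (ν k)]
    (hν : ∀ k, ∀ᵐ x ∂(ν k), x ∈ Set.Icc (0 : ℝ) 1) {Δ : ℝ} (hK : 2 ≤ K) (hNm : 0 < Nm)
    (hΔ : ∀ i j : Fin K, j.val = i.val + 1 → i.val < Nm →
      Δ ≤ mean ν (bestArm ν i) - mean ν (bestArm ν j)) : Δ ≤ 1 := by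
  have h := hΔ ⟨0, by omega⟩ ⟨1, by omega⟩ rfl hNm
  have h1 := mean_mem_Icc hν (bestArm ν ⟨0, by omega⟩)
  have h2 := mean_mem_Icc hν (bestArm ν ⟨1, by omega⟩)
  linarith [h1.2, h2.1]

theorem two_mul_exp_learningTime_le {ε δ : ℝ} (hK : 0 < K) (hT : 0 < T) (hδ : δ ∈ Set.Ioo (0 : ℝ) 1) :
    2 * Real.exp (-(learningTime K T ε δ * 0.02 / (K : ℝ) ^ 2)) ≤ δ / (2 * T) := by
  have hK' : (0 : ℝ) < K := by exact_mod_cast hK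
  have hT' : (0 : ℝ) < T := by exact_mod_cast hT
  have h1 : (K : ℝ) ^ 2 * Real.log (4 * T / δ) / 0.02 ≤ learningTime K T ε δ :=
    (le_max_right _ _).trans (Nat.le_ceil _)
  have h2 : Real.log (4 * T / δ) ≤ learningTime K T ε δ * 0.02 / (K : ℝ) ^ 2 := by
    rw [le_div_iff₀ (by positivity)]
    rw [div_le_iff₀ (by norm_num)] at h1
    linarith
  have hpos : 0 < 4 * T / δ := div_pos (by positivity) hδ.1
  calc 2 * Real.exp (-(learningTime K T ε δ * 0.02 / (K : ℝ) ^ 2))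
      ≤ 2 * Real.exp (-Real.log (4 * T / δ)) := by gcongr
    _ = δ / (2 * T) := by
      rw [Real.exp_neg, Real.exp_log hpos, inv_div]
      field_simp
      ring

theorem exp_learningTime_le {ε δ : ℝ} (hK : 0 < K) (hT : 0 < T) (hε : 0 < ε)
    (hδ : δ ∈ Set.Ioo (0 : ℝ) 1) :
    2 * K * Real.exp (-(learningTime K T ε δ * ε ^ 2 / (16 * K))) ≤ δ / (2 * T) := by
  have hK' : (1 : ℝ) ≤ K := by exact_mod_cast hK
  have hT' : (0 : ℝ) < T := by exact_mod_cast hT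
  have hδ0 := hδ.1
  have h1 : 16 * (K : ℝ) / ε ^ 2 * Real.log (4 * (K : ℝ) ^ 2 / (δ / (2 * T))) ≤
      learningTime K T ε δ :=
    (le_max_right _ _).trans ((le_max_left _ _).trans (Nat.le_ceil _))
  have h2 : Real.log (4 * (K : ℝ) ^ 2 / (δ / (2 * T))) ≤
      learningTime K T ε δ * ε ^ 2 / (16 * K) := by
    rw [le_div_iff₀ (by positivity)]
    rw [div_mul_eq_mul_div, div_le_iff₀ (by positivity)] at h1
    linarith
  have hpos : 0 < 4 * (K : ℝ) ^ 2 / (δ / (2 * T)) := by positivity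
  calc 2 * K * Real.exp (-(learningTime K T ε δ * ε ^ 2 / (16 * K)))
      ≤ 2 * K * Real.exp (-Real.log (4 * (K : ℝ) ^ 2 / (δ / (2 * T)))) := by gcongr
    _ = δ / (2 * T) * (1 / (2 * K)) := by
      rw [Real.exp_neg, Real.exp_log hpos, inv_div]
      field_simp
      norm_num
    _ ≤ δ / (2 * T) * 1 := by
      gcongr
      rw [div_le_one (by positivity)]
      linarith
    _ = _ := mul_one _

/-- Makes the union bound affordable: at most T/T₀ epochs with at most K players each are at most T
pairs. -/
theorem le_learningTime {ε δ : ℝ} (hK : 0 < K) (hT : 0 < T) (hδ : δ ∈ Set.Ioo (0 : ℝ) 1) :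
    K ≤ learningTime K T ε δ := by
  have hK' : (1 : ℝ) ≤ K := by exact_mod_cast hK
  have hT' : (1 : ℝ) ≤ T := by exact_mod_cast hT
  have h1 : (K : ℝ) ^ 2 * Real.log (4 * T / δ) / 0.02 ≤ learningTime K T ε δ :=
    (le_max_right _ _).trans (Nat.le_ceil _)
  have hlog : (0.02 : ℝ) ≤ Real.log (4 * T / δ) := by
    have h4 : (4 : ℝ) ≤ 4 * T / δ := by
      rw [le_div_iff₀ hδ.1]; nlinarith [hδ.2]
    rw [Real.le_log_iff_exp_le (by linarith)]
    have : Real.exp 0.02 ≤ Real.exp 1 := Real.exp_le_exp.mpr (by norm_num)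
    linarith [Real.exp_one_lt_d9]
  have h2 : (K : ℝ) ≤ (K : ℝ) ^ 2 * Real.log (4 * T / δ) / 0.02 := by
    rw [le_div_iff₀ (by norm_num)]
    nlinarith [mul_le_mul_of_nonneg_left hlog (by positivity : (0 : ℝ) ≤ (K : ℝ) ^ 2)]
  exact_mod_cast h2.trans h1

variable [NeZero K] [Fintype P] [∀ k, IsProbabilityMeasure (ν k)]

theorem one_sub_le_gameLaw_goodEvent
    (hν : ∀ k, ∀ᵐ x ∂(ν k), x ∈ Set.Icc (0 : ℝ) 1) (hsrt : IsSorting srt) {Δ ε δ : ℝ}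
    (hT : 0 < T) (hNmK : Nm ≤ K) (hNm : ∀ t < T, (active t).card ≤ Nm)
    (hΔ : ∀ i j : Fin K, j.val = i.val + 1 → i.val < Nm →
      Δ ≤ mean ν (bestArm ν i) - mean ν (bestArm ν j))
    (hε : 0 < ε) (hεΔ : ε < Δ) (hδ : δ ∈ Set.Ioo (0 : ℝ) 1)
    (hT₀ : T₀ = learningTime K T ε δ) (hT₁ : T₀ < T₁)
    (hactive : ∀ t, t + 1 < T → (t + 1) % T₁ ≠ 0 → (t + 1) % T₁ < T₀ →
      active (t + 1) = active t) :
    1 - δ ≤ (gameLaw P ν).real (goodEvent ν srt active T T₀ T₁ ε) := by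
  have hK := NeZero.pos K
  have hKT₀ : K ≤ T₀ := hT₀ ▸ le_learningTime hK hT hδ
  have hT₀pos : 0 < T₀ := by omega
  have hT' : (0 : ℝ) < T := by exact_mod_cast hT
  set M := (Finset.range (T / T₀)).filter fun m => m * T₁ + T₀ ≤ T with hM
  let bad (m : ℕ) (j : P) : Set (Outcome K P) :=
    {ω | ¬ IsCorrectRanking ν ε (ranking srt active T₀ T₁ ω m j)} ∪
      {ω | estimate active T₀ T₁ ω m j ≠ (active (m * T₁)).card}
  have hbad (m : ℕ) (hm : m * T₁ + T₀ ≤ T) (j : P) (hj : j ∈ active (m * T₁)) :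
      (gameLaw P ν).real (bad m j) ≤ δ / T := by
    have hmT : m * T₁ < T := by omega
    have hcard : (active (m * T₁)).card ≤ K := (hNm _ hmT).trans hNmK
    have hconst := active_eq_of_mem_learning hT₁ hactive hm
    have h1 : (gameLaw P ν).real
        {ω | ¬ IsCorrectRanking ν ε (ranking srt active T₀ T₁ ω m j)} ≤ δ / (2 * T) := by
      -- With a single arm the gap condition is void and ε ≤ 1 may fail, but every ranking is
      -- correct.
      rcases Nat.lt_or_ge K 2 with hK2 | hK2
      · have : Subsingleton (Fin K) := by
          obtain rfl : K = 1 := by omega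
          infer_instance
        have : {ω : Outcome K P | ¬ IsCorrectRanking ν ε (ranking srt active T₀ T₁ ω m j)} = ∅ := by
          ext ω
          simp only [Set.mem_ofPred_eq, Set.mem_empty_iff_false, iff_false, not_not]
          intro a b hab
          rw [Subsingleton.elim a b] at hab
          linarith
        rw [this]
        simp only [measureReal_empty]
        exact div_nonneg hδ.1.le (by positivity)
      · have hNmpos : 0 < Nm := (Finset.card_pos.mpr ⟨j, hj⟩).trans_le (hNm _ hmT)
        have hε1 : ε ≤ 1 := hεΔ.le.trans (gap_le_one hν hK2 hNmpos hΔ)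
        refine (gameLaw_not_isCorrectRanking_le ν hν hsrt hε hε1 hj hcard hconst).trans ?_
        rw [hT₀]
        exact exp_learningTime_le hK hT hε hδ
    have h2 : (gameLaw P ν).real {ω | estimate active T₀ T₁ ω m j ≠ (active (m * T₁)).card} ≤
        δ / (2 * T) := by
      refine (gameLaw_estimate_ne_le ν hT₀pos hj hcard hconst).trans ?_
      rw [hT₀]
      exact two_mul_exp_learningTime_le hK hT hδ
    refine (measureReal_union_le _ _).trans ((add_le_add h1 h2).trans (le_of_eq ?_))
    field_simp
    norm_num
  have hsub : (goodEvent ν srt active T T₀ T₁ ε)ᶜ ⊆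
      ⋃ m ∈ M, ⋃ j ∈ active (m * T₁), bad m j := by
    intro ω hω
    simp only [goodEvent, Set.mem_compl_iff, Set.mem_ofPred_eq, not_forall] at hω
    obtain ⟨m, hm, j, hj, h⟩ := hω
    -- Since T₀ < T₁, a completed learning phase of epoch `m` gives (m + 1) T₀ ≤ T.
    have hmM : m ∈ M := by
      rw [hM, Finset.mem_filter, Finset.mem_range]
      refine ⟨?_, hm⟩
      rw [Nat.lt_iff_add_one_le, Nat.le_div_iff_mul_le hT₀pos]
      nlinarith
    simp only [Set.mem_iUnion]
    refine ⟨m, hmM, j, hj, ?_⟩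
    rw [not_and_or] at h
    exact h
  have hcount : (M.card : ℝ) * K ≤ T := by
    have h1 : M.card ≤ T / T₀ := (Finset.card_filter_le _ _).trans (by simp)
    have h2 : M.card * K ≤ T :=
      (Nat.mul_le_mul h1 hKT₀).trans (Nat.div_mul_le_self T T₀)
    exact_mod_cast h2
  have hle : (gameLaw P ν).real (goodEvent ν srt active T T₀ T₁ ε)ᶜ ≤ δ := by
    calc _ ≤ (gameLaw P ν).real (⋃ m ∈ M, ⋃ j ∈ active (m * T₁), bad m j) :=
          measureReal_mono hsub (measure_ne_top _ _)
      _ ≤ ∑ m ∈ M, (gameLaw P ν).real (⋃ j ∈ active (m * T₁), bad m j) :=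
          measureReal_biUnion_finset_le _ _
      _ ≤ ∑ m ∈ M, K * (δ / T) := by
          refine Finset.sum_le_sum fun m hm => ?_
          have hm' := (Finset.mem_filter.mp hm).2
          refine (measureReal_biUnion_finset_le _ _).trans
            ((Finset.sum_le_sum fun j hj => hbad m hm' j hj).trans ?_)
          rw [Finset.sum_const, nsmul_eq_mul]
          have : (((active (m * T₁)).card : ℕ) : ℝ) ≤ K := by
            exact_mod_cast (hNm _ (by omega)).trans hNmK
          exact mul_le_mul_of_nonneg_right this (div_nonneg hδ.1.le hT'.le)
      _ = (M.card * K) * (δ / T) := by rw [Finset.sum_const, nsmul_eq_mul]; ring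
      _ ≤ T * (δ / T) := mul_le_mul_of_nonneg_right hcount (div_nonneg hδ.1.le hT'.le)
      _ = δ := by field_simp
  rw [measureReal_compl (measurableSet_goodEvent hsrt ν T ε), probReal_univ] at hle
  linarith

end GoodEvent

/-! ### The best arms and correct rankings -/

section TopArms

variable {K : ℕ} (ν : Fin K → Measure ℝ)

/-- The `n` best arms. -/
noncomputable def topArms (n : ℕ) : Finset (Fin K) :=
  {k | ((bestArm ν).symm k).val < n}

theorem mem_topArms {n : ℕ} {k : Fin K} :
    k ∈ topArms ν n ↔ ((bestArm ν).symm k).val < n := by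
  simp [topArms]

theorem topArms_eq_map (n : ℕ) : topArms ν n =
    (Finset.univ.filter fun i : Fin K => i.val < n).map (bestArm ν).toEmbedding := by
  ext k
  rw [mem_topArms, Finset.mem_map]
  constructor
  · intro h
    exact ⟨(bestArm ν).symm k, by simpa using h, by simp⟩
  · rintro ⟨i, hi, rfl⟩
    simpa using hi

theorem card_topArms {n : ℕ} (hn : n ≤ K) : (topArms ν n).card = n := by
  rw [topArms_eq_map, Finset.card_map, Fin.card_filter_val_lt]
  omega

theorem topSum_eq (n : ℕ) : topSum ν n = ∑ k ∈ topArms ν n, mean ν k := by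
  rw [topArms_eq_map, Finset.sum_map]
  rfl

theorem antitone_mean_bestArm : Antitone fun i => mean ν (bestArm ν i) := by
  intro i j hij
  have := Tuple.monotone_sort (fun k => -mean ν k) hij
  simpa [Function.comp, bestArm] using this

variable {ν} {Nm : ℕ} {Δ ε : ℝ}

/-- By monotonicity the difference is at least the gap between the consecutive positions n - 1 and
n. -/
theorem gap_le_of_mem_topArms
    (hΔ : ∀ i j : Fin K, j.val = i.val + 1 → i.val < Nm →
      Δ ≤ mean ν (bestArm ν i) - mean ν (bestArm ν j))
    {n : ℕ} (hn : n ≤ Nm) {k l : Fin K} (hk : k ∈ topArms ν n) (hl : l ∉ topArms ν n) :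
    Δ ≤ mean ν k - mean ν l := by
  rw [mem_topArms] at hk hl
  have hl' := ((bestArm ν).symm l).isLt
  have h := hΔ ⟨n - 1, by omega⟩ ⟨n, by omega⟩ (by simp only; omega) (by simp only; omega)
  have h1 := antitone_mean_bestArm ν (a := (bestArm ν).symm k) (b := ⟨n - 1, by omega⟩)
    (by rw [Fin.le_def]; simp only; omega)
  have h2 := antitone_mean_bestArm ν (a := ⟨n, by omega⟩) (b := (bestArm ν).symm l)
    (by rw [Fin.le_def]; simp only; omega)
  simp only [Equiv.apply_symm_apply] at h1 h2
  linarith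

/-- The first `n` arms of a correct ranking are the `n` best ones. -/
theorem IsCorrectRanking.symm_lt_iff
    (hΔ : ∀ i j : Fin K, j.val = i.val + 1 → i.val < Nm →
      Δ ≤ mean ν (bestArm ν i) - mean ν (bestArm ν j))
    (hεΔ : ε < Δ) {A : Equiv.Perm (Fin K)} (hA : IsCorrectRanking ν ε A)
    {n : ℕ} (hn : n ≤ Nm) (hnK : n ≤ K) (k : Fin K) :
    (A.symm k).val < n ↔ k ∈ topArms ν n := by
  have hsub : (Finset.univ.filter fun k => (A.symm k).val < n) ⊆ topArms ν n := by
    intro l hl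
    by_contra hcon
    rw [Finset.mem_filter] at hl
    -- If an arm `l` outside the top `n` stood among the first `n`, all `n` top arms would have to
    -- precede it, by the gap. Equality of the two sets then follows by cardinality.
    have h1 : ((topArms ν n).map A.symm.toEmbedding) ⊆ Finset.Iio (A.symm l) := by
      intro i hi
      obtain ⟨k, hk, rfl⟩ := Finset.mem_map.mp hi
      rw [Finset.mem_Iio]
      exact hA k l (hεΔ.trans_le (gap_le_of_mem_topArms hΔ hn hk hcon))
    have h2 := Finset.card_le_card h1
    rw [Finset.card_map, card_topArms ν hnK, Fin.card_Iio] at h2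
    omega
  have hcard : (Finset.univ.filter fun k => (A.symm k).val < n).card = n := by
    have : (Finset.univ.filter fun k => (A.symm k).val < n) =
        (Finset.univ.filter fun i : Fin K => i.val < n).map A.toEmbedding := by
      ext k
      rw [Finset.mem_map]
      constructor
      · intro h
        exact ⟨A.symm k, by simpa using h, by simp⟩
      · rintro ⟨i, hi, rfl⟩
        simpa using hi
    rw [this, Finset.card_map, Fin.card_filter_val_lt]
    omega
  have := Finset.eq_of_subset_of_card_le hsub (by rw [hcard, card_topArms ν hnK])
  rw [← this]
  simp

end TopArms

/-! ### One round of Musical Chairs after successful learning -/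

section Chairs

variable {K : ℕ} [NeZero K] {P : Type*} [DecidableEq P] {active : ℕ → Finset P} {T T₀ T₁ Nm : ℕ}

/-- What the players present at the start of an epoch know after a successful learning phase: the
set `B` of the best arms, as many as there are players. -/
structure Learned (B : Finset (Fin K)) (S : Finset P) (r : P → Equiv.Perm (Fin K)) (e : P → ℤ) :
    Prop where
  card_eq : B.card = S.card
  estimate_eq : ∀ i ∈ S, e i = S.card
  symm_lt_iff : ∀ i ∈ S, ∀ k, ((r i).symm k).val < S.card ↔ k ∈ B

theorem Synced.mem_epoch_start {t : ℕ} {j : P} (h : Synced active T₁ t j) :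
    j ∈ active (t / T₁ * T₁) :=
  h _ (Finset.mem_Icc.mpr ⟨le_rfl, Nat.div_mul_le_self t T₁⟩)

theorem Synced.mem {t : ℕ} {j : P} (h : Synced active T₁ t j) : j ∈ active t :=
  h _ (Finset.mem_Icc.mpr ⟨Nat.div_mul_le_self t T₁, le_rfl⟩)

theorem lastPosition_val {n : ℕ} (hn : 1 ≤ n) (hnK : n ≤ K) :
    (lastPosition K (n : ℤ)).val + 1 = n := by
  simp only [lastPosition, Int.toNat_natCast]
  omega

variable {B : Finset (Fin K)} {r : P → Equiv.Perm (Fin K)} {e : P → ℤ} {t : ℕ}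
  (hL : Learned B (active (t / T₁ * T₁)) r e)
include hL

theorem Learned.one_le_card {j : P} (hj : Synced active T₁ t j) :
    1 ≤ (active (t / T₁ * T₁)).card := by
  exact Finset.card_pos.mpr ⟨j, hj.mem_epoch_start⟩

theorem Learned.choices_unfixed {j : P} (hj : InChairs active T₀ T₁ t j) {y : P → Coin K}
    {φ : P → Option (Fin K)} (hφ : φ j = none) :
    choices active T₀ T₁ t r e y φ j = r j (Fin.castLE
      (lastPosition K ((active (t / T₁ * T₁)).card : ℤ)).isLt
      ((y j).2 (lastPosition K ((active (t / T₁ * T₁)).card : ℤ)))) := by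
  -- The type of the draw depends on the estimate, so the estimate is generalised before it is
  -- substituted.
  have h (n : ℤ) (hn : n = (active (t / T₁ * T₁)).card) :
      r j (Fin.castLE (lastPosition K n).isLt ((y j).2 (lastPosition K n))) = r j (Fin.castLE
      (lastPosition K ((active (t / T₁ * T₁)).card : ℤ)).isLt
      ((y j).2 (lastPosition K ((active (t / T₁ * T₁)).card : ℤ)))) := by
    subst hn; rfl
  rw [choices, if_pos hj, hφ, Option.getD_none]
  exact h _ (hL.estimate_eq j hj.2.mem_epoch_start)

/-- Lists may order the good arms differently, but each contains every one of them exactly once, so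
each is drawn with probability one over the number of participants. -/
theorem Learned.card_filter_draw {j : P} (hj : Synced active T₁ t j)
    {a : Fin K} (ha : a ∈ B) :
    (Finset.univ.filter fun p : Fin ((lastPosition K ((active (t / T₁ * T₁)).card : ℤ)).val + 1) =>
      r j (Fin.castLE (lastPosition K ((active (t / T₁ * T₁)).card : ℤ)).isLt p) = a).card = 1 := by
  have hcard : (active (t / T₁ * T₁)).card ≤ K := by
    rw [← hL.card_eq]; exact (Finset.card_le_univ _).trans (by simp)
  rw [Finset.card_eq_one]
  refine ⟨⟨((r j).symm a).val, ?_⟩, ?_⟩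
  · rw [lastPosition_val (hL.one_le_card hj) hcard]
    exact (hL.symm_lt_iff j hj.mem_epoch_start a).mpr ha
  · ext p
    simp only [Finset.mem_filter, Finset.mem_univ, true_and, Finset.mem_singleton]
    rw [← Equiv.eq_symm_apply]
    constructor
    · intro h
      ext
      simp [← h]
    · rintro rfl
      ext
      simp

theorem Learned.choices_unfixed_mem {j : P} (hj : InChairs active T₀ T₁ t j) {y : P → Coin K}
    {φ : P → Option (Fin K)} (hφ : φ j = none) : choices active T₀ T₁ t r e y φ j ∈ B := by
  have hcard : (active (t / T₁ * T₁)).card ≤ K := by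
    rw [← hL.card_eq]; exact (Finset.card_le_univ _).trans (by simp)
  rw [hL.choices_unfixed hj hφ, ← hL.symm_lt_iff j hj.2.mem_epoch_start, Equiv.symm_apply_apply]
  have h := lastPosition_val (hL.one_le_card hj.2) hcard
  have h2 := ((y j).2 (lastPosition K ((active (t / T₁ * T₁)).card : ℤ))).isLt
  simp only [Fin.val_castLE]
  omega

/-- Pigeonhole: the other participants number one fewer than the arms in `B`. -/
theorem Learned.exists_free_arm {j : P} (hj : Synced active T₁ t j) {φ : P → Option (Fin K)}
    (hφ : φ j = none) : ∃ a ∈ B, ∀ i, Synced active T₁ t i → φ i ≠ some a := by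
  classical
  set S := active (t / T₁ * T₁) with hS
  -- The default 0 for unfixed players can only enlarge the set of occupied arms; its cardinality
  -- bound is unaffected.
  set F := (S.erase j).image fun i => (φ i).getD 0 with hF
  have hlt : F.card < B.card := by
    rw [hL.card_eq]
    refine Finset.card_image_le.trans_lt ?_
    exact Finset.card_lt_card (Finset.erase_ssubset hj.mem_epoch_start)
  obtain ⟨a, haB, haF⟩ := Finset.exists_mem_notMem_of_card_lt_card hlt
  refine ⟨a, haB, fun i hi h => haF ?_⟩
  rw [hF, Finset.mem_image]
  refine ⟨i, Finset.mem_erase.mpr ⟨?_, hi.mem_epoch_start⟩, by simp [h]⟩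
  rintro rfl
  rw [hφ] at h
  cases h

/-- An unfixed player fixes with probability at least `1 / (e² N)`. -/
theorem Learned.le_coinsLaw_not_collides [Fintype P] (hNmK : Nm ≤ K)
    (hcS : (active (t / T₁ * T₁)).card ≤ Nm) (hct : (active t).card ≤ Nm) {j : P}
    (hj : InChairs active T₀ T₁ t j) {φ : P → Option (Fin K)} (hφ : φ j = none) :
    Real.exp (-2) / Nm ≤
      (coinsLaw K P).real {y | ¬ Collides (active t) (choices active T₀ T₁ t r e y φ) j} := by
  classical
  obtain ⟨a, haB, ha⟩ := hL.exists_free_arm hj.2 hφ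
  set S := active (t / T₁ * T₁) with hS
  set n := lastPosition K (S.card : ℤ) with hn
  have hS1 : 1 ≤ S.card := hL.one_le_card hj.2
  have hnS : n.val + 1 = S.card := lastPosition_val hS1 (hcS.trans hNmK)
  set D : P → Finset (Fin (n.val + 1)) :=
    fun i => Finset.univ.filter fun p => r i (Fin.castLE n.isLt p) = a with hD
  set U := (active t).filter fun i => Synced active T₁ t i ∧ φ i = none with hU
  set X := (active t).filter fun i => ¬ Synced active T₁ t i with hX
  have hjU : j ∈ U := Finset.mem_filter.mpr ⟨hj.2.mem, hj.2, hφ⟩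
  -- A box of coins that suffices: `j` draws the free arm `a`, while the other unfixed participants
  -- `U` and the exploring newcomers `X` avoid it. Fixed participants avoid `a` by its choice.
  let box (i : P) : Set (Coin K) :=
    if i = j then {c | c.2 n ∈ D i} else if i ∈ U then {c | c.2 n ∈ (D i)ᶜ}
    else if i ∈ X then {c | c.1 ∈ ({a} : Finset (Fin K))ᶜ} else Set.univ
  have hsub : Set.univ.pi box ⊆
      {y | ¬ Collides (active t) (choices active T₀ T₁ t r e y φ) j} := by
    intro y hy
    simp only [Set.mem_pi, Set.mem_univ, true_imp_iff, box] at hy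
    have hja : choices active T₀ T₁ t r e y φ j = a := by
      rw [hL.choices_unfixed hj hφ]
      have : (y j).2 n ∈ D j := by
        have := hy j
        rwa [if_pos rfl] at this
      exact (Finset.mem_filter.mp this).2
    rintro ⟨i, hi, hij, h⟩
    rw [hja] at h
    have hyi := hy i
    rw [if_neg hij] at hyi
    by_cases hsync : Synced active T₁ t i
    · rcases hφi : φ i with _ | b
      · have hiU : i ∈ U := Finset.mem_filter.mpr ⟨hi, hsync, hφi⟩
        rw [if_pos hiU] at hyi
        replace hyi : (y i).2 n ∈ (D i)ᶜ := hyi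
        rw [hL.choices_unfixed ⟨hj.1, hsync⟩ hφi] at h
        exact (Finset.mem_compl.mp hyi) (Finset.mem_filter.mpr ⟨Finset.mem_univ _, h⟩)
      · rw [choices, if_pos ⟨hj.1, hsync⟩, hφi, Option.getD_some] at h
        exact ha i hsync (by rw [hφi, h])
    · have hiU : i ∉ U := fun h' => hsync (Finset.mem_filter.mp h').2.1
      have hiX : i ∈ X := Finset.mem_filter.mpr ⟨hi, hsync⟩
      rw [if_neg hiU, if_pos hiX] at hyi
      rw [choices, if_neg fun h' => hsync h'.2] at h
      simp [h] at hyi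
  have hKpos : (0 : ℝ) < K := by exact_mod_cast NeZero.pos K
  have hSpos : (0 : ℝ) < S.card := by exact_mod_cast hS1
  have hfac (i : P) : (coinLaw K (box i)).toReal =
      (if i = j then 1 / (S.card : ℝ) else if i ∈ U then 1 - 1 / (S.card : ℝ) else 1) *
        (if i ∈ X then 1 - 1 / (K : ℝ) else 1) := by
    have hUX : i ∈ U → i ∉ X := fun h1 h2 =>
      (Finset.mem_filter.mp h2).2 (Finset.mem_filter.mp h1).2.1
    have hDi : i ∈ U → (D i).card = 1 := fun h =>
      hL.card_filter_draw (Finset.mem_filter.mp h).2.1 haB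
    simp only [box]
    split_ifs with h1 h2 h3 h4 h5
    · subst h1; exact absurd h2 (hUX hjU)
    · subst h1
      rw [coinLaw_snd, hDi hjU, hnS]
      simp
    · exact absurd h4 (hUX h3)
    · rw [coinLaw_snd, Finset.card_compl, hDi h3, Fintype.card_fin, hnS, ENNReal.toReal_div,
        ENNReal.toReal_natCast, ENNReal.toReal_natCast, Nat.cast_sub hS1]
      field_simp
      simp
    · rw [coinLaw_fst, Finset.card_compl, Finset.card_singleton, Fintype.card_fin,
        ENNReal.toReal_div, ENNReal.toReal_natCast, ENNReal.toReal_natCast,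
        Nat.cast_sub (NeZero.pos K)]
      field_simp
      simp
    · simp
  have hprod : (coinsLaw K P).real (Set.univ.pi box) =
      1 / S.card * (1 - 1 / (S.card : ℝ)) ^ (U.card - 1) * (1 - 1 / (K : ℝ)) ^ X.card := by
    rw [measureReal_def, Measure.pi_pi, ENNReal.toReal_prod, Finset.prod_congr rfl fun i _ => hfac i,
      Finset.prod_mul_distrib, prod_ite_card hjU]
    congr 1
    rw [Finset.prod_ite_mem, Finset.univ_inter, Finset.prod_const]
  have hUS : U.card ≤ S.card := Finset.card_le_card fun i hi =>
    (Finset.mem_filter.mp hi).2.1.mem_epoch_start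
  have hXc : X.card < K := by
    have : X.card < (active t).card := Finset.card_lt_card
      (Finset.filter_ssubset.mpr ⟨j, hj.2.mem, fun h => h hj.2⟩)
    omega
  have hUpos : 0 < U.card := Finset.card_pos.mpr ⟨j, hjU⟩
  -- One factor 1/e comes from the participants and one from the newcomers; the latter are fewer
  -- than K because `j` is present too.
  have h1 := exp_neg_one_le_pow (K := S.card) (n := U.card - 1) (by omega) (by omega)
  have h2 := exp_neg_one_le_pow (K := K) (n := X.card) (by omega) hXc
  calc Real.exp (-2) / Nm = 1 / Nm * Real.exp (-1) * Real.exp (-1) := by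
        rw [mul_assoc, ← Real.exp_add]; norm_num; ring
    _ ≤ 1 / S.card * (1 - 1 / (S.card : ℝ)) ^ (U.card - 1) * (1 - 1 / (K : ℝ)) ^ X.card := by
        gcongr
        exact mul_nonneg (by positivity) ((Real.exp_pos _).le.trans h1)
    _ = (coinsLaw K P).real (Set.univ.pi box) := hprod.symm
    _ ≤ _ := measureReal_mono hsub (measure_ne_top _ _)

end Chairs

/-! ### The expected time to fix -/

section FixTime

variable {K : ℕ} [NeZero K] {P : Type*} [DecidableEq P] {active : ℕ → Finset P} {T T₀ T₁ Nm : ℕ}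
  {srt : (Fin K → ℝ) → Equiv.Perm (Fin K)} {ν : Fin K → Measure ℝ} {Δ ε : ℝ}

theorem learned_of_mem_goodEvent (hNmK : Nm ≤ K) (hNm : ∀ t < T, (active t).card ≤ Nm)
    (hΔ : ∀ i j : Fin K, j.val = i.val + 1 → i.val < Nm →
      Δ ≤ mean ν (bestArm ν i) - mean ν (bestArm ν j))
    (hεΔ : ε < Δ) {ω : Outcome K P} (hω : ω ∈ goodEvent ν srt active T T₀ T₁ ε) {t : ℕ}
    (ht : t < T) (htT₀ : T₀ ≤ t % T₁) :
    Learned (topArms ν (active (t / T₁ * T₁)).card) (active (t / T₁ * T₁))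
      (ranking srt active T₀ T₁ ω (t / T₁)) (estimate active T₀ T₁ ω (t / T₁)) := by
  have h1 := Nat.div_add_mod t T₁
  rw [mul_comm] at h1
  have hc := hNm (t / T₁ * T₁) (by omega)
  have hG := hω (t / T₁) (by omega)
  exact ⟨card_topArms ν (hc.trans hNmK), fun i hi => (hG i hi).2, fun i hi k =>
    (hG i hi).1.symm_lt_iff hΔ hεΔ hc (hc.trans hNmK) k⟩

theorem Synced.of_succ {t : ℕ} {j : P} (hdiv : (t + 1) / T₁ = t / T₁)
    (h : Synced active T₁ (t + 1) j) : Synced active T₁ t j := by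
  intro s hs
  refine h s ?_
  rw [Finset.mem_Icc] at hs ⊢
  rw [hdiv]
  omega

theorem succ_mod_of_div_eq {t : ℕ} (hdiv : (t + 1) / T₁ = t / T₁) :
    (t + 1) % T₁ = t % T₁ + 1 := by
  have h1 := Nat.div_add_mod t T₁
  have h2 := Nat.div_add_mod (t + 1) T₁
  rw [hdiv] at h2
  omega

variable [Fintype P] [∀ k, IsProbabilityMeasure (ν k)]

theorem roundLaw_real_coins (A : Set (P → Coin K)) :
    (roundLaw P ν).real {x | x.2 ∈ A} = (coinsLaw K P).real A := by
  have : {x : Round K P | x.2 ∈ A} = Set.univ ×ˢ A := by ext; simp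
  rw [this, roundLaw, measureReal_prod_prod, probReal_univ, one_mul]

/-- Round `t` is resampled with all other rounds kept. This changes neither the good event nor the
fixed arms before round `t`, so the one-round bound on fixing applies pointwise. -/
theorem gameLaw_unfixed_succ_le (hsrt : IsSorting srt) (hNmK : Nm ≤ K)
    (hNm : ∀ t < T, (active t).card ≤ Nm)
    (hΔ : ∀ i j : Fin K, j.val = i.val + 1 → i.val < Nm →
      Δ ≤ mean ν (bestArm ν i) - mean ν (bestArm ν j))
    (hεΔ : ε < Δ) (hT₁ : T₀ < T₁) {t : ℕ} {j : P} (ht : t < T) (htT₀ : T₀ ≤ t % T₁)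
    (hdiv : (t + 1) / T₁ = t / T₁) (hj : InChairs active T₀ T₁ (t + 1) j) :
    (gameLaw P ν).real
      (goodEvent ν srt active T T₀ T₁ ε ∩ {ω | fixedArm srt active T₀ T₁ ω (t + 1) j = none}) ≤
    (1 - Real.exp (-2) / Nm) * (gameLaw P ν).real
      (goodEvent ν srt active T T₀ T₁ ε ∩ {ω | fixedArm srt active T₀ T₁ ω t j = none}) := by
  set G := goodEvent ν srt active T T₀ T₁ ε with hG
  have hGm : MeasurableSet G := measurableSet_goodEvent hsrt ν T ε
  set A := G ∩ {ω | fixedArm srt active T₀ T₁ ω t j = none} with hA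
  set A' := G ∩ {ω | fixedArm srt active T₀ T₁ ω (t + 1) j = none} with hA'
  have hAm : MeasurableSet A := hGm.inter (measurableSet_unfixed hsrt t j)
  have hAm' : MeasurableSet A' := hGm.inter (measurableSet_unfixed hsrt (t + 1) j)
  have hjt : InChairs active T₀ T₁ t j := ⟨htT₀, hj.2.of_succ hdiv⟩
  have hmod := succ_mod_of_div_eq hdiv
  have hdm := Nat.div_add_mod t T₁
  rw [mul_comm] at hdm
  have hle (ω : Outcome K P) : roundLaw P ν {x | Function.update ω t x ∈ A'} ≤
      A.indicator (fun _ => ENNReal.ofReal (1 - Real.exp (-2) / Nm)) ω := by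
    have hsucc (x : Round K P) : fixedArm srt active T₀ T₁ (Function.update ω t x) (t + 1) j =
        fixStep active T₀ T₁ t (fixedArm srt active T₀ T₁ ω t) (choices active T₀ T₁ t
          (ranking srt active T₀ T₁ ω (t / T₁)) (estimate active T₀ T₁ ω (t / T₁)) x.2
          (fixedArm srt active T₀ T₁ ω t)) j := by
      rw [fixedArm_succ, fixedArm_update hT₁ htT₀ ω x le_rfl, arm_update hT₁ htT₀]
    by_cases hωA : ω ∈ A
    · obtain ⟨hωG, hω⟩ := hωA
      rw [Set.indicator_of_mem (show ω ∈ A from ⟨hωG, hω⟩)]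
      have hL := learned_of_mem_goodEvent hNmK hNm hΔ hεΔ hωG ht htT₀
      have hp := hL.le_coinsLaw_not_collides hNmK (hNm _ (by omega)) (hNm t ht) hjt hω
      set C : Set (P → Coin K) := {y | ¬ Collides (active t) (choices active T₀ T₁ t
        (ranking srt active T₀ T₁ ω (t / T₁)) (estimate active T₀ T₁ ω (t / T₁)) y
        (fixedArm srt active T₀ T₁ ω t)) j} with hC
      have hsub : {x | Function.update ω t x ∈ A'} ⊆ {x : Round K P | x.2 ∈ Cᶜ} := by
        intro x hx hxC
        have h1 := hx.2
        simp only [Set.mem_ofPred_eq, hsucc] at h1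
        rw [fixStep, if_neg (by omega), if_pos ⟨hω, hjt, hxC⟩] at h1
        cases h1
      refine (measure_mono hsub).trans ?_
      rw [← ENNReal.ofReal_toReal (measure_ne_top (roundLaw P ν) _)]
      refine ENNReal.ofReal_le_ofReal ?_
      have := roundLaw_real_coins (ν := ν) Cᶜ
      rw [measureReal_def] at this
      rw [this, measureReal_compl MeasurableSet.of_discrete, probReal_univ]
      linarith
    -- Outside `A` the resampled event is empty: the good event fails, or the player is already
    -- fixed and remains so within the epoch.
    · rw [Set.indicator_of_notMem hωA]
      refine le_of_eq (measure_mono_null (t := ∅) ?_ measure_empty)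
      intro x hx
      have hxG : ω ∈ G := (update_mem_goodEvent_iff hT₁ htT₀ ω x ν T ε).mp hx.1
      have h1 := hx.2
      simp only [Set.mem_ofPred_eq, hsucc] at h1
      have h2 : fixedArm srt active T₀ T₁ ω t j ≠ none := fun h => hωA ⟨hxG, h⟩
      rw [fixStep, if_neg (by omega), if_neg fun h => h2 h.1] at h1
      exact absurd h1 h2
  have hp1 : Real.exp (-2) / Nm ≤ 1 := by
    have hN : (1 : ℝ) ≤ Nm := by
      exact_mod_cast (Finset.card_pos.mpr ⟨j, hjt.2.mem⟩).trans_le (hNm t ht)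
    rw [div_le_one (by linarith)]
    exact (Real.exp_le_one_iff.mpr (by norm_num)).trans hN
  have h1 : gameLaw P ν A' ≤ ENNReal.ofReal (1 - Real.exp (-2) / Nm) * gameLaw P ν A := by
    rw [gameLaw_apply_update ν t hAm']
    refine (lintegral_mono hle).trans (le_of_eq ?_)
    rw [lintegral_indicator_const hAm]
  have h2 := ENNReal.toReal_mono (ENNReal.mul_ne_top ENNReal.ofReal_ne_top
    (measure_ne_top _ _)) h1
  rwa [ENNReal.toReal_mul, ENNReal.toReal_ofReal (by linarith)] at h2

theorem isProbabilityMeasure_goodLaw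
    (h : 0 < (gameLaw P ν).real (goodEvent ν srt active T T₀ T₁ ε)) :
    IsProbabilityMeasure (goodLaw ν srt active T T₀ T₁ ε) :=
  cond_isProbabilityMeasure fun h0 => by
    rw [measureReal_def, h0] at h
    simp at h

theorem cond_real_apply_eq {Ω : Type*} [MeasurableSpace Ω] (μ : Measure Ω) {s : Set Ω}
    (hs : MeasurableSet s) (A : Set Ω) :
    (cond μ s).real A = (μ.real s)⁻¹ * μ.real (s ∩ A) := by
  rw [measureReal_def, cond_apply hs, ENNReal.toReal_mul, ENNReal.toReal_inv]
  rfl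

theorem goodLaw_unfixed_succ_le (hsrt : IsSorting srt) (hNmK : Nm ≤ K)
    (hNm : ∀ t < T, (active t).card ≤ Nm)
    (hΔ : ∀ i j : Fin K, j.val = i.val + 1 → i.val < Nm →
      Δ ≤ mean ν (bestArm ν i) - mean ν (bestArm ν j))
    (hεΔ : ε < Δ) (hT₁ : T₀ < T₁) {t : ℕ} {j : P} (ht : t < T) (htT₀ : T₀ ≤ t % T₁)
    (hdiv : (t + 1) / T₁ = t / T₁) (hj : InChairs active T₀ T₁ (t + 1) j) :
    (goodLaw ν srt active T T₀ T₁ ε).real {ω | fixedArm srt active T₀ T₁ ω (t + 1) j = none} ≤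
    (1 - Real.exp (-2) / Nm) * (goodLaw ν srt active T T₀ T₁ ε).real
      {ω | fixedArm srt active T₀ T₁ ω t j = none} := by
  have h := gameLaw_unfixed_succ_le hsrt hNmK hNm hΔ hεΔ hT₁ ht htT₀ hdiv hj
  unfold goodLaw
  rw [cond_real_apply_eq _ (measurableSet_goodEvent hsrt ν T ε),
    cond_real_apply_eq _ (measurableSet_goodEvent hsrt ν T ε), mul_left_comm]
  exact mul_le_mul_of_nonneg_left h (inv_nonneg.mpr measureReal_nonneg)

theorem fixTime_eq_sum (m : ℕ) (j : P) (ω : Outcome K P) :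
    fixTime srt active T T₀ T₁ m j ω = ∑ t ∈ Finset.range T,
      if t / T₁ = m ∧ InChairs active T₀ T₁ t j then
        {ω | fixedArm srt active T₀ T₁ ω t j = none}.indicator (fun _ => (1 : ℝ)) ω else 0 := by
  unfold fixTime
  rw [Finset.card_filter, Nat.cast_sum]
  refine Finset.sum_congr rfl fun t _ => ?_
  by_cases h : t / T₁ = m ∧ InChairs active T₀ T₁ t j
  · rw [if_pos h, Set.indicator_apply]
    simp [h]
  · rw [if_neg h, if_neg fun h' => h ⟨h'.1, h'.2.1⟩]
    simp

theorem integrable_fixTime (hsrt : IsSorting srt) (ρ : Measure (Outcome K P)) [IsFiniteMeasure ρ]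
    (m : ℕ) (j : P) : Integrable (fixTime srt active T T₀ T₁ m j) ρ := by
  refine Integrable.of_bound (measurable_fixTime hsrt T m j).aestronglyMeasurable T ?_
  refine Filter.Eventually.of_forall fun ω => ?_
  unfold fixTime
  rw [Real.norm_natCast]
  exact_mod_cast (Finset.card_filter_le _ _).trans (by simp)

/-- The expected count is the sum of the probabilities of being unfixed, which is dominated by a
geometric series of ratio 1 - p with sum 1/p. -/
theorem integral_fixTime_le (hsrt : IsSorting srt) (hNmK : Nm ≤ K)
    (hNm : ∀ t < T, (active t).card ≤ Nm)
    (hΔ : ∀ i j : Fin K, j.val = i.val + 1 → i.val < Nm →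
      Δ ≤ mean ν (bestArm ν i) - mean ν (bestArm ν j))
    (hεΔ : ε < Δ) (hT₁ : T₀ < T₁) [IsProbabilityMeasure (goodLaw ν srt active T T₀ T₁ ε)]
    (m : ℕ) (j : P) :
    ∫ ω, fixTime srt active T T₀ T₁ m j ω ∂(goodLaw ν srt active T T₀ T₁ ε) ≤
      Real.exp 2 * Nm := by
  set ρ := goodLaw ν srt active T T₀ T₁ ε with hρ
  set b : ℕ → ℝ := fun t => if t / T₁ = m ∧ InChairs active T₀ T₁ t j then
    ρ.real {ω | fixedArm srt active T₀ T₁ ω t j = none} else 0 with hb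
  have hint : ∫ ω, fixTime srt active T T₀ T₁ m j ω ∂ρ = ∑ t ∈ Finset.range T, b t := by
    simp only [fixTime_eq_sum]
    rw [integral_finsetSum]
    · refine Finset.sum_congr rfl fun t _ => ?_
      simp only [hb]
      split_ifs
      · rw [integral_indicator_const _ (measurableSet_unfixed hsrt t j)]
        simp
      · simp
    · intro t _
      split_ifs
      · exact (integrable_const _).indicator (measurableSet_unfixed hsrt t j)
      · exact integrable_zero _ _ _
  rw [hint]
  have hT₁pos : 0 < T₁ := by omega
  -- Without players all terms vanish; this case is separated because p = exp(-2)/Nm must be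
  -- positive.
  rcases Nat.eq_zero_or_pos Nm with hN0 | hNpos
  · refine (Finset.sum_nonpos fun t ht => ?_).trans (by positivity)
    simp only [hb]
    rw [if_neg]
    rintro ⟨-, -, h⟩
    have := (Finset.card_pos.mpr ⟨j, h.mem⟩).trans_le (hNm t (Finset.mem_range.mp ht))
    omega
  have hN : (1 : ℝ) ≤ Nm := by exact_mod_cast hNpos
  set p : ℝ := Real.exp (-2) / Nm with hp
  have hp0 : 0 < p := by positivity
  have hp1 : p ≤ 1 := by
    rw [hp, div_le_one (by linarith)]
    exact (Real.exp_le_one_iff.mpr (by norm_num)).trans hN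
  set s := m * T₁ + T₀ with hs
  have hcond {t : ℕ} (h : t / T₁ = m ∧ InChairs active T₀ T₁ t j) : s ≤ t := by
    have h1 := Nat.div_add_mod t T₁
    rw [h.1, mul_comm] at h1
    have := h.2.1
    omega
  have hzero (t : ℕ) (ht : t < s) : b t = 0 := by
    simp only [hb]
    rw [if_neg fun h => by have := hcond h; omega]
  have hgeom (n : ℕ) (hn : s + n < T) : b (s + n) ≤ (1 - p) ^ n := by
    induction n with
    | zero =>
      simp only [hb, pow_zero]
      split_ifs
      · exact measureReal_le_one
      · exact zero_le_one
    | succ n ih =>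
      have hpow : 0 ≤ (1 - p) ^ n := pow_nonneg (by linarith) _
      by_cases h : (s + n + 1) / T₁ = m ∧ InChairs active T₀ T₁ (s + n + 1) j
      · have hmod := Nat.div_add_mod (s + n + 1) T₁
        have hlt := Nat.mod_lt (s + n + 1) hT₁pos
        rw [h.1, mul_comm] at hmod
        obtain ⟨hd, hr⟩ := div_mod_of_mem_Ico (m := m) (t := s + n) (T₁ := T₁)
          ⟨by omega, by rw [add_mul]; omega⟩
        have hdiv : (s + n + 1) / T₁ = (s + n) / T₁ := by rw [h.1, hd]
        have htT₀ : T₀ ≤ (s + n) % T₁ := by omega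
        have hstep := goodLaw_unfixed_succ_le hsrt hNmK hNm hΔ hεΔ hT₁ (by omega) htT₀ hdiv h.2
        have hb1 : b (s + (n + 1)) =
            ρ.real {ω | fixedArm srt active T₀ T₁ ω (s + n + 1) j = none} := if_pos h
        have hb0 : b (s + n) = ρ.real {ω | fixedArm srt active T₀ T₁ ω (s + n) j = none} :=
          if_pos ⟨hd, htT₀, h.2.2.of_succ hdiv⟩
        rw [hb1, pow_succ, mul_comm]
        refine hstep.trans ?_
        rw [← hb0]
        exact mul_le_mul_of_nonneg_left (ih (by omega)) (by linarith)
      -- The epoch has ended or the player has not been present throughout it, so the round is not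
      -- counted.
      · have hb1 : b (s + (n + 1)) = 0 := if_neg h
        rw [hb1]
        exact pow_nonneg (by linarith) _
  have hfin : ∑ t ∈ Finset.range T, b t ≤ 1 / p := by
    rcases Nat.lt_or_ge T s with hTs | hTs
    · rw [Finset.sum_eq_zero fun t ht => hzero t (by have := Finset.mem_range.mp ht; omega)]
      positivity
    · obtain ⟨n, rfl⟩ := Nat.exists_eq_add_of_le hTs
      rw [Finset.sum_range_add, Finset.sum_eq_zero fun t ht => hzero t (Finset.mem_range.mp ht),
        zero_add]
      refine (Finset.sum_le_sum fun i hi =>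
        hgeom i (by have := Finset.mem_range.mp hi; omega)).trans ?_
      rw [le_div_iff₀ hp0, mul_comm]
      have := mul_neg_geom_sum (1 - p) n
      rw [sub_sub_cancel] at this
      rw [this]
      linarith [pow_nonneg (by linarith : 0 ≤ 1 - p) n]
  refine hfin.trans (le_of_eq ?_)
  rw [hp, Real.exp_neg]
  field_simp

theorem expectedFixTime_le (hsrt : IsSorting srt) (hNmK : Nm ≤ K)
    (hNm : ∀ t < T, (active t).card ≤ Nm)
    (hΔ : ∀ i j : Fin K, j.val = i.val + 1 → i.val < Nm →
      Δ ≤ mean ν (bestArm ν i) - mean ν (bestArm ν j))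
    (hεΔ : ε < Δ) (hT₁ : T₀ < T₁) [IsProbabilityMeasure (goodLaw ν srt active T T₀ T₁ ε)] :
    expectedFixTime ν srt active T T₀ T₁ ε ≤ Real.exp 2 * Nm :=
  Real.iSup_le (fun p => integral_fixTime_le hsrt hNmK hNm hΔ hεΔ hT₁ p.1 p.2) (by positivity)

end FixTime

/-! ### Regret of a single round -/

section RoundRegret

/-- If all players in `F` choose distinct arms among the `N` best ones, then the regret of a round
is controlled by the number of other players and the number of missing players. -/
theorem topSum_sub_reward_le {K : ℕ} {P : Type*} [DecidableEq P] {ν : Fin K → Measure ℝ}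
    (hmean : ∀ k, mean ν k ∈ Set.Icc (0 : ℝ) 1) {A F : Finset P} {a : P → Fin K} {N d : ℕ}
    (hAK : A.card ≤ K) (hNK : N ≤ K) (hFA : F ⊆ A) (hinj : Set.InjOn a F)
    (hmem : ∀ i ∈ F, a i ∈ topArms ν N) (hN : N ≤ A.card + d) :
    topSum ν A.card - ∑ j ∈ A, (if Collides A a j then 0 else mean ν (a j)) ≤
      2 * (A \ F).card + d := by
  classical
  set Fg := F.filter fun j => ¬ Collides A a j with hFg
  have hFgF : Fg ⊆ F := Finset.filter_subset _ _
  -- Members of `F` never collide with each other, so each colliding one shares her arm with a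
  -- player outside `F`. Distinct members have distinct arms, so the arms count them.
  have hbadcard : (F \ Fg).card ≤ (A \ F).card := by
    rw [← Finset.card_image_of_injOn (hinj.mono (Finset.coe_subset.mpr Finset.sdiff_subset))]
    refine (Finset.card_le_card (t := (A \ F).image a) fun k hk => ?_).trans Finset.card_image_le
    obtain ⟨j, hj, rfl⟩ := Finset.mem_image.mp hk
    rw [Finset.mem_sdiff, hFg, Finset.mem_filter, not_and, not_not] at hj
    obtain ⟨i, hi, hij, h⟩ := hj.2 hj.1
    refine Finset.mem_image.mpr ⟨i, Finset.mem_sdiff.mpr ⟨hi, fun hiF => hij ?_⟩, h⟩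
    exact hinj hiF hj.1 h
  have hreward : ∑ k ∈ Fg.image a, mean ν k ≤
      ∑ j ∈ A, (if Collides A a j then 0 else mean ν (a j)) := by
    rw [Finset.sum_image (hinj.mono (Finset.coe_subset.mpr hFgF))]
    calc ∑ j ∈ Fg, mean ν (a j) = ∑ j ∈ Fg, (if Collides A a j then 0 else mean ν (a j)) :=
          Finset.sum_congr rfl fun j hj => by rw [if_neg (Finset.mem_filter.mp hj).2]
      _ ≤ _ := Finset.sum_le_sum_of_subset_of_nonneg (hFgF.trans hFA) fun j _ _ => by
          split_ifs
          · exact le_rfl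
          · exact (hmean _).1
  -- The top `M` arms contain both the benchmark arms and the arms of `F`. At most `M - Fg.card` of
  -- them go unrewarded, each costing at most 1.
  set M := max A.card N with hM
  have hMK : M ≤ K := max_le hAK hNK
  have hsub : Fg.image a ⊆ topArms ν M := by
    intro k hk
    obtain ⟨j, hj, rfl⟩ := Finset.mem_image.mp hk
    rw [mem_topArms]
    exact ((mem_topArms ν).mp (hmem j (hFgF hj))).trans_le (le_max_right _ _)
  have htop : topSum ν A.card ≤ ∑ k ∈ topArms ν M, mean ν k := by
    rw [topSum_eq]
    refine Finset.sum_le_sum_of_subset_of_nonneg (fun k hk => ?_) fun k _ _ => (hmean k).1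
    rw [mem_topArms] at hk ⊢
    exact hk.trans_le (le_max_left _ _)
  have hrest : ∑ k ∈ topArms ν M \ Fg.image a, mean ν k ≤ ((M - Fg.card : ℕ) : ℝ) := by
    refine (Finset.sum_le_card_nsmul _ _ 1 fun k _ => (hmean k).2).trans (le_of_eq ?_)
    rw [Finset.card_sdiff_of_subset hsub, card_topArms ν hMK,
      Finset.card_image_of_injOn (hinj.mono (Finset.coe_subset.mpr hFgF))]
    simp
  have hsplit := Finset.sum_sdiff (f := mean ν) hsub
  have hcount : M - Fg.card ≤ 2 * (A \ F).card + d := by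
    have h1 := Finset.card_sdiff_add_card_eq_card hFgF
    have h2 := Finset.card_sdiff_add_card_eq_card hFA
    have h3 : M ≤ A.card + d := max_le (Nat.le_add_right _ _) hN
    omega
  have hcount' : ((M - Fg.card : ℕ) : ℝ) ≤ 2 * (A \ F).card + d := by exact_mod_cast hcount
  linarith

variable {K : ℕ} [NeZero K] {P : Type*} [DecidableEq P] {active : ℕ → Finset P} {T T₀ T₁ Nm : ℕ}
  {srt : (Fin K → ℝ) → Equiv.Perm (Fin K)} {ν : Fin K → Measure ℝ} {Δ ε : ℝ}

theorem InChairs.arm_eq_of_fixedArm {ω : Outcome K P} {t : ℕ} {j : P} {a : Fin K}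
    (hj : InChairs active T₀ T₁ t j) (h : fixedArm srt active T₀ T₁ ω t j = some a) :
    arm srt active T₀ T₁ ω t j = a := by
  rw [arm_eq_choices, choices, if_pos hj, h, Option.getD_some]

/-- Players who are fixed are fixed on distinct arms among the best ones. -/
theorem fixedArm_eq_some (hNmK : Nm ≤ K) (hNm : ∀ t < T, (active t).card ≤ Nm)
    (hΔ : ∀ i j : Fin K, j.val = i.val + 1 → i.val < Nm →
      Δ ≤ mean ν (bestArm ν i) - mean ν (bestArm ν j))
    (hεΔ : ε < Δ) {ω : Outcome K P} (hω : ω ∈ goodEvent ν srt active T T₀ T₁ ε)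
    {t : ℕ} (ht : t < T) {i : P} (hi : Synced active T₁ t i) {a : Fin K}
    (hia : fixedArm srt active T₀ T₁ ω t i = some a) :
    T₀ ≤ t % T₁ ∧ a ∈ topArms ν (active (t / T₁ * T₁)).card ∧
      ∀ i', Synced active T₁ t i' → fixedArm srt active T₀ T₁ ω t i' = some a → i' = i := by
  induction t generalizing i a with
  | zero => cases hia
  | succ t ih =>
    have ht' : t < T := by omega
    by_cases hmod0 : (t + 1) % T₁ = 0
    · rw [fixedArm_succ, fixStep, if_pos hmod0] at hia
      cases hia
    have hdiv : (t + 1) / T₁ = t / T₁ := by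
      rw [Nat.succ_div, if_neg fun h => hmod0 (Nat.mod_eq_zero_of_dvd h), add_zero]
    have hmod := succ_mod_of_div_eq hdiv
    -- Whoever is fixed on `a` after round `t` played `a` in it, either fixed already or without
    -- collision. If two such players were both fixed before, induction applies; otherwise one of
    -- them would have collided. `Synced` is essential: a departed player keeps her recorded arm
    -- although it may be taken again.
    have key {i : P} {a : Fin K} (hi : Synced active T₁ (t + 1) i)
        (hia : fixedArm srt active T₀ T₁ ω (t + 1) i = some a) :
        T₀ ≤ t % T₁ ∧ a ∈ topArms ν (active (t / T₁ * T₁)).card ∧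
        arm srt active T₀ T₁ ω t i = a ∧ (fixedArm srt active T₀ T₁ ω t i = some a ∨
          ¬ Collides (active t) (arm srt active T₀ T₁ ω t) i) := by
      rw [fixedArm_succ, fixStep, if_neg hmod0] at hia
      split_ifs at hia with h
      · obtain ⟨h1, h2, h3⟩ := h
        have hL := learned_of_mem_goodEvent hNmK hNm hΔ hεΔ hω ht' h2.1
        have harm : arm srt active T₀ T₁ ω t i = a := Option.some_injective _ hia
        refine ⟨h2.1, ?_, harm, Or.inr h3⟩
        rw [← harm, arm_eq_choices]
        exact hL.choices_unfixed_mem h2 h1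
      · obtain ⟨h1, h2, -⟩ := ih ht' (hi.of_succ hdiv) hia
        exact ⟨h1, h2, InChairs.arm_eq_of_fixedArm ⟨h1, hi.of_succ hdiv⟩ hia, Or.inl hia⟩
    obtain ⟨h1, h2, h3, h4⟩ := key hi hia
    refine ⟨by omega, hdiv ▸ h2, fun i' hi' hia' => ?_⟩
    obtain ⟨-, -, h3', h4'⟩ := key hi' hia'
    by_contra hne
    rcases h4 with h4 | h4
    · rcases h4' with h4' | h4'
      · exact hne ((ih ht' (hi.of_succ hdiv) h4).2.2 i' (hi'.of_succ hdiv) h4')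
      · exact h4' ⟨i, (hi.of_succ hdiv).mem, Ne.symm hne, h3.trans h3'.symm⟩
    · exact h4 ⟨i', (hi'.of_succ hdiv).mem, hne, h3'.trans h3.symm⟩

/-- The regret of one Musical Chairs round on the good event. -/
theorem chairs_round_regret_le (hmean : ∀ k, mean ν k ∈ Set.Icc (0 : ℝ) 1)
    (hNmK : Nm ≤ K) (hNm : ∀ t < T, (active t).card ≤ Nm)
    (hΔ : ∀ i j : Fin K, j.val = i.val + 1 → i.val < Nm →
      Δ ≤ mean ν (bestArm ν i) - mean ν (bestArm ν j))
    (hεΔ : ε < Δ) {ω : Outcome K P} (hω : ω ∈ goodEvent ν srt active T T₀ T₁ ε)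
    {t : ℕ} (ht : t < T) (htT₀ : T₀ ≤ t % T₁) :
    topSum ν (active t).card - ∑ j ∈ active t,
      (if Collides (active t) (arm srt active T₀ T₁ ω t) j then 0
        else mean ν (arm srt active T₀ T₁ ω t j)) ≤
      2 * ((active (t / T₁ * T₁)).filter fun j => InChairs active T₀ T₁ t j ∧
          fixedArm srt active T₀ T₁ ω t j = none).card +
        2 * ((active t).filter fun j => ¬ Synced active T₁ t j).card +
        ((active (t / T₁ * T₁)).filter fun j => ¬ Synced active T₁ t j).card := by
  set S := active (t / T₁ * T₁) with hS
  set U := S.filter fun j => InChairs active T₀ T₁ t j ∧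
    fixedArm srt active T₀ T₁ ω t j = none with hU
  set X := (active t).filter fun j => ¬ Synced active T₁ t j with hX
  set D := S.filter fun j => ¬ Synced active T₁ t j with hD
  set F := (active t).filter fun j => Synced active T₁ t j ∧
    fixedArm srt active T₀ T₁ ω t j ≠ none with hF
  have hSN : S.card ≤ Nm := hNm _ ((Nat.div_mul_le_self t T₁).trans_lt ht)
  have hSAD : S ⊆ active t ∪ D := by
    intro j hj
    by_cases h : Synced active T₁ t j
    · exact Finset.mem_union_left _ h.mem
    · exact Finset.mem_union_right _ (Finset.mem_filter.mpr ⟨hj, h⟩)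
  have hfix (i : P) (hi : i ∈ F) : ∃ a, fixedArm srt active T₀ T₁ ω t i = some a ∧
      arm srt active T₀ T₁ ω t i = a := by
    obtain ⟨h1, h2, h3⟩ := Finset.mem_filter.mp hi
    obtain ⟨a, ha⟩ := Option.ne_none_iff_exists'.mp h3
    exact ⟨a, ha, InChairs.arm_eq_of_fixedArm ⟨htT₀, h2⟩ ha⟩
  -- Non-members of `F` are unfixed or newcomers and carry weight 2, while `D` accounts with weight
  -- 1 for the shortfall from the initial number of players. These are the coefficients of the final
  -- bound.
  have h := topSum_sub_reward_le (ν := ν) hmean (A := active t) (F := F)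
    (a := arm srt active T₀ T₁ ω t) (N := S.card) (d := D.card)
    ((hNm t ht).trans hNmK) (hSN.trans hNmK) (Finset.filter_subset _ _)
    (by
      intro i hi i' hi' h
      obtain ⟨a, ha, ha'⟩ := hfix i hi
      obtain ⟨b, hb, hb'⟩ := hfix i' hi'
      have hab : b = a := by rw [← ha', ← hb', h]
      subst hab
      exact (fixedArm_eq_some hNmK hNm hΔ hεΔ hω ht (Finset.mem_filter.mp hi').2.1 hb).2.2 i
        (Finset.mem_filter.mp hi).2.1 ha)
    (by
      intro i hi
      obtain ⟨a, ha, ha'⟩ := hfix i hi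
      rw [ha']
      exact (fixedArm_eq_some hNmK hNm hΔ hεΔ hω ht (Finset.mem_filter.mp hi).2.1 ha).2.1)
    ((Finset.card_le_card hSAD).trans (Finset.card_union_le _ _))
  have hAF : active t \ F ⊆ U ∪ X := by
    intro j hj
    obtain ⟨h1, h2⟩ := Finset.mem_sdiff.mp hj
    by_cases hs : Synced active T₁ t j
    · refine Finset.mem_union_left _ (Finset.mem_filter.mpr ⟨hs.mem_epoch_start, ⟨htT₀, hs⟩, ?_⟩)
      by_contra hne
      exact h2 (Finset.mem_filter.mpr ⟨h1, hs, hne⟩)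
    · exact Finset.mem_union_right _ (Finset.mem_filter.mpr ⟨h1, hs⟩)
  have hcard : ((active t \ F).card : ℝ) ≤ U.card + X.card := by
    exact_mod_cast (Finset.card_le_card hAF).trans (Finset.card_union_le _ _)
  linarith

theorem round_regret_le (hmean : ∀ k, mean ν k ∈ Set.Icc (0 : ℝ) 1) {A : Finset P}
    (hA : A.card ≤ K) (a : P → Fin K) :
    topSum ν A.card - ∑ j ∈ A, (if Collides A a j then 0 else mean ν (a j)) ≤ A.card := by
  have h1 : topSum ν A.card ≤ A.card := by
    rw [topSum_eq]
    refine (Finset.sum_le_card_nsmul _ _ 1 fun k _ => (hmean k).2).trans (le_of_eq ?_)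
    rw [card_topArms ν hA]
    simp
  have h2 : 0 ≤ ∑ j ∈ A, (if Collides A a j then 0 else mean ν (a j)) :=
    Finset.sum_nonneg fun j _ => by
      split_ifs
      · exact le_rfl
      · exact (hmean _).1
  linarith

end RoundRegret

/-! ### Charging rounds to epochs, entries and departures -/

section Counting

variable {T T₀ T₁ : ℕ}

theorem card_learning_rounds_le (hT₁ : T₀ < T₁) {E : ℕ} (hE : T ≤ E * T₁) :
    ((Finset.range T).filter fun t => t % T₁ < T₀).card ≤ E * T₀ := by
  have h := Finset.card_le_card_of_injOn (s := (Finset.range T).filter fun t => t % T₁ < T₀)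
    (t := Finset.range E ×ˢ Finset.range T₀) (fun t => (t / T₁, t % T₁)) (by
      intro t ht
      have ht := Finset.mem_filter.mp (Finset.mem_coe.mp ht)
      simp only [Finset.coe_product, Set.mem_prod, Finset.mem_coe, Finset.mem_range]
      refine ⟨?_, ht.2⟩
      rw [Nat.div_lt_iff_lt_mul (by omega)]
      exact (Finset.mem_range.mp ht.1).trans_le hE) (by
      intro s _ t _ hst
      simp only [Prod.mk.injEq] at hst
      rw [← Nat.div_add_mod s T₁, ← Nat.div_add_mod t T₁, hst.1, hst.2])
  simpa using h

theorem card_chairs_rounds_le (hpos : 0 < T₁) (q : ℕ) :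
    ((Finset.range T).filter fun t => T₀ ≤ t % T₁ ∧ q = t / T₁).card ≤ T₁ - T₀ := by
  have h := Finset.card_le_card_of_injOn
    (s := (Finset.range T).filter fun t => T₀ ≤ t % T₁ ∧ q = t / T₁)
    (t := Finset.Ico T₀ T₁) (fun t => t % T₁) (by
      intro t ht
      have ht := Finset.mem_filter.mp (Finset.mem_coe.mp ht)
      simp only [Finset.coe_Ico, Set.mem_Ico]
      exact ⟨ht.2.1, Nat.mod_lt _ hpos⟩) (by
      intro s hs t ht hst
      have hs := (Finset.mem_filter.mp (Finset.mem_coe.mp hs)).2.2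
      have ht := (Finset.mem_filter.mp (Finset.mem_coe.mp ht)).2.2
      simp only at hst
      rw [← Nat.div_add_mod s T₁, ← Nat.div_add_mod t T₁, hst, ← hs, ← ht])
  simpa using h

/-- After exchanging the sums, a change of players following round `s` is charged only to the
Musical Chairs rounds of its own epoch. -/
theorem sum_chairs_le (hpos : 0 < T₁) {f g : ℕ → ℕ}
    (h : ∀ t < T, f t ≤ ∑ s ∈ Finset.range (T - 1), if s / T₁ = t / T₁ then g s else 0) :
    ∑ t ∈ Finset.range T with T₀ ≤ t % T₁, f t ≤
      (∑ s ∈ Finset.range (T - 1), g s) * (T₁ - T₀) := by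
  calc ∑ t ∈ Finset.range T with T₀ ≤ t % T₁, f t
      ≤ ∑ t ∈ Finset.range T with T₀ ≤ t % T₁, ∑ s ∈ Finset.range (T - 1),
          (if s / T₁ = t / T₁ then g s else 0) :=
        Finset.sum_le_sum fun t ht => h t (Finset.mem_range.mp (Finset.mem_filter.mp ht).1)
    _ = ∑ s ∈ Finset.range (T - 1), ∑ t ∈ Finset.range T with T₀ ≤ t % T₁,
          (if s / T₁ = t / T₁ then g s else 0) := Finset.sum_comm
    _ ≤ ∑ s ∈ Finset.range (T - 1), g s * (T₁ - T₀) := by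
        refine Finset.sum_le_sum fun s _ => ?_
        rw [← Finset.sum_filter, Finset.filter_filter, Finset.sum_const, smul_eq_mul, mul_comm]
        exact Nat.mul_le_mul_left _ (card_chairs_rounds_le hpos _)
    _ = _ := (Finset.sum_mul _ _ _).symm

theorem exists_switch {p : ℕ → Prop} {a b : ℕ} (hab : a ≤ b) (ha : ¬ p a) (hb : p b) :
    ∃ s, a ≤ s ∧ s < b ∧ ¬ p s ∧ p (s + 1) := by
  induction b, hab using Nat.le_induction with
  | base => exact absurd hb ha
  | succ b hab ih =>
    by_cases h : p b
    · obtain ⟨s, h1, h2, h3⟩ := ih h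
      exact ⟨s, h1, by omega, h3⟩
    · exact ⟨b, hab, by omega, h, hb⟩

variable {P : Type*} [DecidableEq P] {active : ℕ → Finset P}

theorem card_le_sum_of_forall_exists {A : Finset P} {B : ℕ → Finset P} {t : ℕ} (ht : t < T)
    (h : ∀ x ∈ A, ∃ s, t / T₁ * T₁ ≤ s ∧ s < t ∧ x ∈ B s) :
    A.card ≤ ∑ s ∈ Finset.range (T - 1), if s / T₁ = t / T₁ then (B s).card else 0 := by
  rw [← Finset.sum_filter]
  refine (Finset.card_le_card fun x hx => ?_).trans Finset.card_biUnion_le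
  obtain ⟨s, h1, h2, h3⟩ := h x hx
  refine Finset.mem_biUnion.mpr ⟨s, Finset.mem_filter.mpr ⟨Finset.mem_range.mpr (by omega), ?_⟩, h3⟩
  refine le_antisymm (Nat.div_le_div_right h2.le) ?_
  rcases Nat.eq_zero_or_pos T₁ with rfl | hpos
  · simp
  · exact (Nat.le_div_iff_mul_le hpos).mpr h1

/-- A player present now but absent earlier in the epoch has entered in between; `exists_switch`
finds the round. -/
theorem sum_entered_le (hpos : 0 < T₁) :
    ∑ t ∈ Finset.range T with T₀ ≤ t % T₁,
      ((active t).filter fun j => ¬ Synced active T₁ t j).card ≤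
      entering active T * (T₁ - T₀) := by
  refine sum_chairs_le hpos fun t ht => card_le_sum_of_forall_exists
    (B := fun s => active (s + 1) \ active s) ht fun x hx => ?_
  obtain ⟨hxt, hx⟩ := Finset.mem_filter.mp hx
  simp only [Synced, not_forall] at hx
  obtain ⟨s, hs, hxs⟩ := hx
  obtain ⟨h1, h2⟩ := Finset.mem_Icc.mp hs
  obtain ⟨u, hu1, hu2, hu3, hu4⟩ := exists_switch (p := fun s => x ∈ active s) h2 hxs hxt
  exact ⟨u, h1.trans hu1, hu2, Finset.mem_sdiff.mpr ⟨hu4, hu3⟩⟩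

theorem sum_left_le (hpos : 0 < T₁) :
    ∑ t ∈ Finset.range T with T₀ ≤ t % T₁,
      ((active (t / T₁ * T₁)).filter fun j => ¬ Synced active T₁ t j).card ≤
      leaving active T * (T₁ - T₀) := by
  refine sum_chairs_le hpos fun t ht => card_le_sum_of_forall_exists
    (B := fun s => active s \ active (s + 1)) ht fun x hx => ?_
  obtain ⟨hxt, hx⟩ := Finset.mem_filter.mp hx
  simp only [Synced, not_forall] at hx
  obtain ⟨s, hs, hxs⟩ := hx
  obtain ⟨h1, h2⟩ := Finset.mem_Icc.mp hs
  obtain ⟨u, hu1, hu2, hu3, hu4⟩ := exists_switch (p := fun s => x ∉ active s) h1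
    (not_not.mpr hxt) hxs
  exact ⟨u, hu1, hu2.trans_le h2, Finset.mem_sdiff.mpr ⟨not_not.mp hu3, hu4⟩⟩

end Counting

/-! ### From the pathwise bound to the expected regret -/

section Regret

variable {K : ℕ} [NeZero K] {P : Type*} [DecidableEq P] {active : ℕ → Finset P} {T T₀ T₁ Nm : ℕ}
  {srt : (Fin K → ℝ) → Equiv.Perm (Fin K)} {ν : Fin K → Measure ℝ} {Δ ε : ℝ}

theorem div_lt_ceil {t : ℕ} (hpos : 0 < T₁) (ht : t < T) : t / T₁ < ⌈(T : ℝ) / T₁⌉₊ := by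
  rw [Nat.lt_ceil, lt_div_iff₀ (by exact_mod_cast hpos)]
  exact_mod_cast (Nat.div_mul_le_self t T₁).trans_lt ht

theorem mul_lt_of_lt_ceil {m : ℕ} (hpos : 0 < T₁) (hm : m < ⌈(T : ℝ) / T₁⌉₊) : m * T₁ < T := by
  rw [Nat.lt_ceil, lt_div_iff₀ (by exact_mod_cast hpos)] at hm
  exact_mod_cast hm

theorem le_ceil_mul (hpos : 0 < T₁) : T ≤ ⌈(T : ℝ) / T₁⌉₊ * T₁ := by
  have h := Nat.le_ceil ((T : ℝ) / T₁)
  rw [div_le_iff₀ (by exact_mod_cast hpos)] at h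
  exact_mod_cast h

/-- Double counting of unfixed players, by rounds and by epochs. -/
theorem sum_unfixed_le (hpos : 0 < T₁) (ω : Outcome K P) :
    ∑ t ∈ Finset.range T with T₀ ≤ t % T₁,
      (((active (t / T₁ * T₁)).filter fun j => InChairs active T₀ T₁ t j ∧
          fixedArm srt active T₀ T₁ ω t j = none).card : ℝ) ≤
      ∑ m ∈ Finset.range ⌈(T : ℝ) / T₁⌉₊, ∑ j ∈ active (m * T₁),
        fixTime srt active T T₀ T₁ m j ω := by
  have h1 : ∑ m ∈ Finset.range ⌈(T : ℝ) / T₁⌉₊, ∑ j ∈ active (m * T₁),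
        fixTime srt active T T₀ T₁ m j ω =
      ∑ t ∈ Finset.range T, ∑ m ∈ Finset.range ⌈(T : ℝ) / T₁⌉₊, ∑ j ∈ active (m * T₁),
        if t / T₁ = m ∧ InChairs active T₀ T₁ t j ∧ fixedArm srt active T₀ T₁ ω t j = none
          then (1 : ℝ) else 0 := by
    rw [Finset.sum_comm]
    refine Finset.sum_congr rfl fun m _ => ?_
    rw [Finset.sum_comm]
    refine Finset.sum_congr rfl fun j _ => ?_
    rw [fixTime, Finset.card_filter]
    push_cast
    rfl
  have h0 (t m : ℕ) (j : P) : (0 : ℝ) ≤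
      if t / T₁ = m ∧ InChairs active T₀ T₁ t j ∧ fixedArm srt active T₀ T₁ ω t j = none
          then (1 : ℝ) else 0 := by
    split_ifs
    · exact zero_le_one
    · exact le_rfl
  rw [h1]
  refine le_trans ?_ (Finset.sum_le_sum_of_subset_of_nonneg
    (Finset.filter_subset (fun t => T₀ ≤ t % T₁) _) fun t _ _ => Finset.sum_nonneg fun m _ => Finset.sum_nonneg fun j _ => h0 t m j)
  refine Finset.sum_le_sum fun t ht => ?_
  have ht := Finset.mem_range.mp (Finset.mem_filter.mp ht).1
  refine le_trans (le_of_eq ?_) (Finset.single_le_sum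
    (f := fun m => ∑ j ∈ active (m * T₁), if t / T₁ = m ∧ InChairs active T₀ T₁ t j ∧
      fixedArm srt active T₀ T₁ ω t j = none then (1 : ℝ) else 0)
    (fun m _ => Finset.sum_nonneg fun j _ => h0 t m j)
    (Finset.mem_range.mpr (div_lt_ceil hpos ht)))
  rw [Finset.card_filter]
  push_cast
  simp only [true_and]

/-- A pathwise bound in which only the fixing times are still random, so taking expectations leaves
only these to estimate. -/
theorem regret_le (hmean : ∀ k, mean ν k ∈ Set.Icc (0 : ℝ) 1)
    (hNmK : Nm ≤ K) (hNm : ∀ t < T, (active t).card ≤ Nm)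
    (hΔ : ∀ i j : Fin K, j.val = i.val + 1 → i.val < Nm →
      Δ ≤ mean ν (bestArm ν i) - mean ν (bestArm ν j))
    (hεΔ : ε < Δ) (hT₁ : T₀ < T₁) {ω : Outcome K P}
    (hω : ω ∈ goodEvent ν srt active T T₀ T₁ ε) :
    regret ν srt active T T₀ T₁ ω ≤ (⌈(T : ℝ) / T₁⌉₊ : ℝ) * T₀ * Nm +
      2 * ∑ m ∈ Finset.range ⌈(T : ℝ) / T₁⌉₊, ∑ j ∈ active (m * T₁),
        fixTime srt active T T₀ T₁ m j ω +
      2 * (entering active T * ((T₁ : ℝ) - T₀)) + leaving active T * ((T₁ : ℝ) - T₀) := by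
  have hpos : 0 < T₁ := by omega
  have hsub : ((T₁ - T₀ : ℕ) : ℝ) = (T₁ : ℝ) - T₀ := Nat.cast_sub hT₁.le
  have hU := sum_unfixed_le (T := T) (T₀ := T₀) (srt := srt) (active := active) hpos ω
  have hX : ((∑ t ∈ Finset.range T with T₀ ≤ t % T₁,
      ((active t).filter fun j => ¬ Synced active T₁ t j).card : ℕ) : ℝ) ≤
      entering active T * ((T₁ : ℝ) - T₀) := by
    rw [← hsub]; exact_mod_cast sum_entered_le (T := T) (T₀ := T₀) (active := active) hpos
  have hD : ((∑ t ∈ Finset.range T with T₀ ≤ t % T₁,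
      ((active (t / T₁ * T₁)).filter fun j => ¬ Synced active T₁ t j).card : ℕ) : ℝ) ≤
      leaving active T * ((T₁ : ℝ) - T₀) := by
    rw [← hsub]; exact_mod_cast sum_left_le (T := T) (T₀ := T₀) (active := active) hpos
  have hlearn : ∑ t ∈ Finset.range T with ¬ T₀ ≤ t % T₁, (topSum ν (active t).card -
      ∑ j ∈ active t, if Collides (active t) (arm srt active T₀ T₁ ω t) j then 0
        else mean ν (arm srt active T₀ T₁ ω t j)) ≤ (⌈(T : ℝ) / T₁⌉₊ : ℝ) * T₀ * Nm := by
    refine (Finset.sum_le_card_nsmul _ _ (Nm : ℝ) fun t ht => ?_).trans ?_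
    · have ht := hNm t (Finset.mem_range.mp (Finset.mem_filter.mp ht).1)
      exact (round_regret_le hmean (ht.trans hNmK) _).trans (by exact_mod_cast ht)
    · rw [nsmul_eq_mul]
      refine mul_le_mul_of_nonneg_right ?_ (Nat.cast_nonneg _)
      simp only [not_le]
      exact_mod_cast card_learning_rounds_le hT₁ (le_ceil_mul hpos)
  have hchairs := Finset.sum_le_sum fun t (ht : t ∈ (Finset.range T).filter fun t => T₀ ≤ t % T₁) =>
    chairs_round_regret_le hmean hNmK hNm hΔ hεΔ hω
      (Finset.mem_range.mp (Finset.mem_filter.mp ht).1) (Finset.mem_filter.mp ht).2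
  rw [Finset.sum_add_distrib, Finset.sum_add_distrib, ← Finset.mul_sum, ← Finset.mul_sum]
    at hchairs
  push_cast at hX hD
  unfold regret
  rw [← Finset.sum_filter_add_sum_filter_not (Finset.range T) (fun t => T₀ ≤ t % T₁)]
  linarith

variable [Fintype P] [∀ k, IsProbabilityMeasure (ν k)]

theorem integrable_regret (hsrt : IsSorting srt) (ρ : Measure (Outcome K P)) [IsFiniteMeasure ρ] :
    Integrable (regret ν srt active T T₀ T₁) ρ := by
  let g (t : ℕ) (a : P → Fin K) : ℝ := topSum ν (active t).card -
    ∑ j ∈ active t, if Collides (active t) a j then 0 else mean ν (a j)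
  refine Integrable.of_bound (measurable_regret hsrt ν T).aestronglyMeasurable
    (∑ t ∈ Finset.range T, ∑ a, ‖g t a‖) (Filter.Eventually.of_forall fun ω => ?_)
  refine (norm_sum_le _ _).trans (Finset.sum_le_sum fun t _ => ?_)
  exact Finset.single_le_sum (f := fun a => ‖g t a‖) (fun _ _ => norm_nonneg _)
    (Finset.mem_univ (arm srt active T₀ T₁ ω t))

theorem integral_fixTime_le_expectedFixTime {m : ℕ} (hm : m < ⌈(T : ℝ) / T₁⌉₊) (j : P) :
    ∫ ω, fixTime srt active T T₀ T₁ m j ω ∂(goodLaw ν srt active T T₀ T₁ ε) ≤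
      expectedFixTime ν srt active T T₀ T₁ ε :=
  le_ciSup (f := fun p : Fin ⌈(T : ℝ) / T₁⌉₊ × P =>
    ∫ ω, fixTime srt active T T₀ T₁ p.1 p.2 ω ∂(goodLaw ν srt active T T₀ T₁ ε))
    -- Boundedness is needed because an unbounded real supremum is 0 by convention; here the index
    -- set is finite.
    (Set.finite_range _).bddAbove (⟨m, hm⟩, j)

theorem expectedFixTime_nonneg : 0 ≤ expectedFixTime ν srt active T T₀ T₁ ε :=
  Real.iSup_nonneg fun _ => integral_nonneg fun _ => Nat.cast_nonneg _

theorem integral_regret_le (hsrt : IsSorting srt) (hmean : ∀ k, mean ν k ∈ Set.Icc (0 : ℝ) 1)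
    (hNmK : Nm ≤ K) (hNm : ∀ t < T, (active t).card ≤ Nm)
    (hΔ : ∀ i j : Fin K, j.val = i.val + 1 → i.val < Nm →
      Δ ≤ mean ν (bestArm ν i) - mean ν (bestArm ν j))
    (hεΔ : ε < Δ) (hT₁ : T₀ < T₁) [IsProbabilityMeasure (goodLaw ν srt active T T₀ T₁ ε)] :
    ∫ ω, regret ν srt active T T₀ T₁ ω ∂(goodLaw ν srt active T T₀ T₁ ε) ≤
      (⌈(T : ℝ) / T₁⌉₊ : ℝ) * (Nm * (T₀ + 2 * expectedFixTime ν srt active T T₀ T₁ ε)) +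
        entering active T * (2 * ((T₁ : ℝ) - T₀)) + leaving active T * ((T₁ : ℝ) - T₀) := by
  have hpos : 0 < T₁ := by omega
  set ρ := goodLaw ν srt active T T₀ T₁ ε with hρ
  set E := ⌈(T : ℝ) / T₁⌉₊ with hE
  set τ := expectedFixTime ν srt active T T₀ T₁ ε with hτ
  have hae : ∀ᵐ ω ∂ρ, ω ∈ goodEvent ν srt active T T₀ T₁ ε :=
    ae_cond_mem (measurableSet_goodEvent hsrt ν T ε)
  have hint (m : ℕ) : Integrable (fun ω => ∑ j ∈ active (m * T₁),
      fixTime srt active T T₀ T₁ m j ω) ρ :=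
    integrable_finsetSum _ fun j _ => integrable_fixTime hsrt ρ m j
  have hint2 : Integrable (fun ω => ∑ m ∈ Finset.range E, ∑ j ∈ active (m * T₁),
      fixTime srt active T T₀ T₁ m j ω) ρ := integrable_finsetSum _ fun m _ => hint m
  have h1 : ∫ ω, ∑ m ∈ Finset.range E, ∑ j ∈ active (m * T₁),
      fixTime srt active T T₀ T₁ m j ω ∂ρ ≤ E * (Nm * τ) := by
    rw [integral_finsetSum _ fun m _ => hint m]
    refine (Finset.sum_le_card_nsmul _ _ (Nm * τ) fun m hm => ?_).trans (le_of_eq (by simp))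
    have hm := Finset.mem_range.mp hm
    rw [integral_finsetSum _ fun j _ => integrable_fixTime hsrt ρ m j]
    refine (Finset.sum_le_card_nsmul _ _ τ fun j _ =>
      integral_fixTime_le_expectedFixTime hm j).trans ?_
    rw [nsmul_eq_mul]
    exact mul_le_mul_of_nonneg_right (by exact_mod_cast hNm _ (mul_lt_of_lt_ceil hpos hm))
      expectedFixTime_nonneg
  have h2 := integral_mono_ae (integrable_regret (active := active) (T := T) (T₀ := T₀) (T₁ := T₁)
      (ν := ν) hsrt ρ)
    ((((integrable_const ((E : ℝ) * T₀ * Nm)).add (hint2.const_mul 2)).add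
      (integrable_const (2 * (entering active T * ((T₁ : ℝ) - T₀))))).add
      (integrable_const (leaving active T * ((T₁ : ℝ) - T₀))))
    (hae.mono fun ω hω => regret_le hmean hNmK hNm hΔ hεΔ hT₁ hω)
  have h3 : ∫ ω, 2 * ∑ m ∈ Finset.range E, ∑ j ∈ active (m * T₁),
      fixTime srt active T T₀ T₁ m j ω ∂ρ = 2 * ∫ ω, ∑ m ∈ Finset.range E, ∑ j ∈ active (m * T₁),
      fixTime srt active T T₀ T₁ m j ω ∂ρ := integral_const_mul _ _
  refine h2.trans ?_
  simp only [Pi.add_apply]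
  rw [integral_add (by fun_prop) (by fun_prop), integral_add (by fun_prop) (by fun_prop),
    integral_add (by fun_prop) (by fun_prop)]
  simp only [integral_const, probReal_univ, one_smul, h3]
  linarith

end Regret

end DMC

theorem lemma4 {K : ℕ} [NeZero K] {P : Type*} [Fintype P] [DecidableEq P]
    (ν : Fin K → Measure ℝ) [∀ k, IsProbabilityMeasure (ν k)]
    (hν : ∀ k, ∀ᵐ x ∂(ν k), x ∈ Set.Icc (0 : ℝ) 1)
    (srt : (Fin K → ℝ) → Equiv.Perm (Fin K)) (hsrt : DMC.IsSorting srt)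
    (active : ℕ → Finset P) (T T₀ T₁ Nm : ℕ) (Δ ε δ : ℝ)
    (hT : 0 < T) (hNmK : Nm ≤ K)
    (hNm : ∀ t < T, (active t).card ≤ Nm)
    (hΔ : ∀ i j : Fin K, j.val = i.val + 1 → i.val < Nm →
      Δ ≤ DMC.mean ν (DMC.bestArm ν i) - DMC.mean ν (DMC.bestArm ν j))
    (hε : 0 < ε) (hεΔ : ε < Δ) (hδ : δ ∈ Set.Ioo (0 : ℝ) 1)
    (hT₀ : T₀ = DMC.learningTime K T ε δ) (hT₁ : T₀ < T₁)
    (hactive : ∀ t, t + 1 < T → (t + 1) % T₁ ≠ 0 → (t + 1) % T₁ < T₀ →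
      active (t + 1) = active t) :
    MeasurableSet (DMC.goodEvent ν srt active T T₀ T₁ ε) ∧
    1 - δ ≤ (DMC.gameLaw P ν).real (DMC.goodEvent ν srt active T T₀ T₁ ε) ∧
    (∀ m j, Integrable (DMC.fixTime srt active T T₀ T₁ m j)
      (DMC.goodLaw ν srt active T T₀ T₁ ε)) ∧
    DMC.expectedFixTime ν srt active T T₀ T₁ ε ≤ Real.exp 2 * Nm ∧
    Integrable (DMC.regret ν srt active T T₀ T₁) (DMC.goodLaw ν srt active T T₀ T₁ ε) ∧
    ∫ ω, DMC.regret ν srt active T T₀ T₁ ω ∂(DMC.goodLaw ν srt active T T₀ T₁ ε) ≤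
      (⌈(T : ℝ) / T₁⌉₊ : ℝ) *
          (Nm * (T₀ + 2 * DMC.expectedFixTime ν srt active T T₀ T₁ ε)) +
        DMC.entering active T * (2 * ((T₁ : ℝ) - T₀)) +
        DMC.leaving active T * ((T₁ : ℝ) - T₀) := by
  have hmean := DMC.mean_mem_Icc hν
  have hG := DMC.one_sub_le_gameLaw_goodEvent hν hsrt hT hNmK hNm hΔ hε hεΔ hδ hT₀ hT₁ hactive
  have hprob : IsProbabilityMeasure (DMC.goodLaw ν srt active T T₀ T₁ ε) :=
    -- As δ < 1, the good event has positive probability and conditioning on it is meaningful.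
    DMC.isProbabilityMeasure_goodLaw (by linarith [hδ.2])
  exact ⟨DMC.measurableSet_goodEvent hsrt ν T ε, hG,
    fun m j => DMC.integrable_fixTime hsrt _ m j,
    DMC.expectedFixTime_le hsrt hNmK hNm hΔ hεΔ hT₁,
    DMC.integrable_regret hsrt _,
    DMC.integral_regret_le hsrt hmean hNmK hNm hΔ hεΔ hT₁⟩
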